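/- **Theorem.** Let $V=\mathbb{R}^7$ and let $\mathrm{GL}(7)$ act on the $35$-dimensional space $\wedge^3V^*$ of alternating trilinear forms by $(f\cdot\Omega)(X,Y,Z)=\Omega(f^{-1}X,f^{-1}Y,f^{-1}Z)$. A form $\Omega\in\wedge^3V^*$ is *generic* if its $\mathrm{GL}(7)$-orbit is open in $\wedge^3V^*$. The wedge product of covectors is normalised by $(\alpha_1\wedge\alpha_2\wedge\alpha_3)(X_1,X_2,X_3)=\det(\alpha_j(X_i))$. Let $(E_0,E_1,E_2,E_3,F_1,F_2,F_3)$ be the canonical basis of $\mathbb{R}^7$ and put $$\Omega_0=-2\,(E_0^*\wedge E_1^*\wedge F_1^*+E_0^*\wedge E_2^*\wedge F_2^*+E_0^*\wedge E_3^*\wedge F_3^*)-4\,E_1^*\wedge E_2^*\wedge E_3^*+4\,F_1^*\wedge F_2^*\wedge F_3^*.$$ For any basis $\{e_i^*\}_{i=1}^7$ of $(\mathbb{R}^7)^*$, with $e^{ijk}:=e_i^*\wedge e_j^*\wedge e_k^*$, put $$\Omega_1=e^{147}+e^{257}+e^{367}+e^{123}-e^{156}+e^{246}-e^{345}.$$ For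 $\Omega\in\wedge^3V^*$ and a basis $\mathcal{B}=\{b_1,\dots,b_7\}$ of $V$, let $$n_{\Omega,\mathcal{B}}(X,Y)=\sum_{\sigma\in S_7}\operatorname{sign}(\sigma)\,\Omega(X,b_{\sigma(1)},b_{\sigma(2)})\,\Omega(Y,b_{\sigma(3)},b_{\sigma(4)})\,\Omega(b_{\sigma(5)},b_{\sigma(6)},b_{\sigma(7)}).$$ A *norm associated with* $\Omega$ is a nondegenerate symmetric bilinear form $n$ on $V$, equal to $c\,n_{\Omega,\mathcal{B}}$ for some basis $\mathcal{B}$ and some $c\in\mathbb{R}\setminus\{0\}$, such that the product $\times\colon V\times V\to V$ given by $n(X\times Y,Z)=\Omega(X,Y,Z)$ is a cross product relative to $n$, that is, for all $X,Y\in V$, $$n(X\times Y,X)=n(X\times Y,Y)=0,\qquad n(X\times Y,X\times Y)=n(X,X)\,n(Y,Y)-n(X,Y)^2.$$ The *signature* of $n$ is the pair $(q,p)$, where $q$ is the number of negative and $p$ the number of positive entries in a diagonal form of $X\mapsto n(X,X)$. Then there are exactly two $\mathrm{GL}(7)$-orbits of generic $3$-forms in $\wedge^3(\mathbb{R}^7)^*$,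 namely the orbit of $\Omega_0$ and the orbit of $\Omega_1$, and these are distinct. Every generic $3$-form has exactly one associated norm. This norm has signature $(4,3)$ if the form lies in the orbit of $\Omega_0$, and signature $(0,7)$ if it lies in the orbit of $\Omega_1$. -/

import Mathlib

noncomputable section

/-- The pull-back action of `f ∈ GL(n)` on `p`-forms on `ℝⁿ`:
`(f · Ω)(X₁, …, Xₚ) = Ω(f⁻¹ X₁, …, f⁻¹ Xₚ)`. -/
def glAct {n p : ℕ} (f : (Fin n → ℝ) ≃L[ℝ] (Fin n → ℝ)) (Ω : (Fin n → ℝ) [⋀^Fin p]→L[ℝ] ℝ) :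
    (Fin n → ℝ) [⋀^Fin p]→L[ℝ] ℝ :=
  Ω.compContinuousLinearMap (f.symm : (Fin n → ℝ) →L[ℝ] (Fin n → ℝ))

/-- The `GL(n)`-orbit of a `p`-form on `ℝⁿ`. -/
def glOrbit {n p : ℕ} (Ω : (Fin n → ℝ) [⋀^Fin p]→L[ℝ] ℝ) :
    Set ((Fin n → ℝ) [⋀^Fin p]→L[ℝ] ℝ) :=
  Set.range fun f : (Fin n → ℝ) ≃L[ℝ] (Fin n → ℝ) => glAct f Ω

/-- A `p`-form on `ℝⁿ` is generic when its `GL(n)`-orbit is open in the (finite-dimensional)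
space of `p`-forms. -/
def IsGeneric {n p : ℕ} (Ω : (Fin n → ℝ) [⋀^Fin p]→L[ℝ] ℝ) : Prop :=
  IsOpen (glOrbit Ω)

/-- The space `∧³(ℝ⁷)*` of 3-forms on `ℝ⁷`. -/
abbrev ThreeForm : Type := (Fin 7 → ℝ) [⋀^Fin 3]→L[ℝ] ℝ

/-- The wedge product `α₁ ∧ α₂ ∧ α₃` of three covectors, normalised by
`(α₁ ∧ α₂ ∧ α₃)(X₁, X₂, X₃) = det (αⱼ(Xᵢ))`. -/
def wedge3 (α₁ α₂ α₃ : Module.Dual ℝ (Fin 7 → ℝ)) : ThreeForm :=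
  { (Matrix.detRowAlternating (R := ℝ) (n := Fin 3)).compLinearMap
      (LinearMap.pi ![α₁, α₂, α₃]) with
    cont := by
      have h : Continuous fun x : Fin 3 → Fin 7 → ℝ =>
          (Matrix.of fun i => LinearMap.pi ![α₁, α₂, α₃] (x i)).det := by
        apply Continuous.matrix_det
        apply continuous_pi
        intro i
        exact (LinearMap.continuous_of_finiteDimensional
          (LinearMap.pi ![α₁, α₂, α₃] : (Fin 7 → ℝ) →ₗ[ℝ] (Fin 3 → ℝ))).comp (continuous_apply i)
      exact h }

/-- The determinant formula for `wedge3`. -/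
theorem wedge3_apply (α₁ α₂ α₃ : Module.Dual ℝ (Fin 7 → ℝ)) (x : Fin 3 → Fin 7 → ℝ) :
    wedge3 α₁ α₂ α₃ x = (Matrix.of fun i j => (![α₁, α₂, α₃] j) (x i)).det := rfl

/-- The dual `xᵢ` of the canonical basis vector `eᵢ` of `ℝ⁷`. -/
def coord7 (i : Fin 7) : Module.Dual ℝ (Fin 7 → ℝ) := LinearMap.proj i

/-- The split 3-form
`Ω₀ = -2 (E₀*∧E₁*∧F₁* + E₀*∧E₂*∧F₂* + E₀*∧E₃*∧F₃*) - 4 E₁*∧E₂*∧E₃* + 4 F₁*∧F₂*∧F₃*`,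
where `(E₀, E₁, E₂, E₃, F₁, F₂, F₃)` is the canonical basis of `ℝ⁷`, in this order. -/
def Omega0 : ThreeForm :=
  (-2 : ℝ) • (wedge3 (coord7 0) (coord7 1) (coord7 4) + wedge3 (coord7 0) (coord7 2) (coord7 5)
      + wedge3 (coord7 0) (coord7 3) (coord7 6))
    - (4 : ℝ) • wedge3 (coord7 1) (coord7 2) (coord7 3)
    + (4 : ℝ) • wedge3 (coord7 4) (coord7 5) (coord7 6)

/-- `Ω₁ = e¹⁴⁷ + e²⁵⁷ + e³⁶⁷ + e¹²³ - e¹⁵⁶ + e²⁴⁶ - e³⁴⁵` for a basis of `(ℝ⁷)*`; the members of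
the basis are numbered from `0` here. -/
def Omega1 (e : Module.Basis (Fin 7) ℝ (Module.Dual ℝ (Fin 7 → ℝ))) : ThreeForm :=
  wedge3 (e 0) (e 3) (e 6) + wedge3 (e 1) (e 4) (e 6) + wedge3 (e 2) (e 5) (e 6)
    + wedge3 (e 0) (e 1) (e 2) - wedge3 (e 0) (e 4) (e 5) + wedge3 (e 1) (e 3) (e 5)
    - wedge3 (e 2) (e 3) (e 4)

/-- The symmetric bilinear form `n_{Ω,B}` attached to a 3-form `Ω` and a basis `B` of `ℝ⁷`:
`n_{Ω,B}(X,Y) = ∑_σ sign(σ) Ω(X, b_σ1, b_σ2) Ω(Y, b_σ3, b_σ4) Ω(b_σ5, b_σ6, b_σ7)`. -/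
def normForm (Ω : ThreeForm) (b : Module.Basis (Fin 7) ℝ (Fin 7 → ℝ)) :
    LinearMap.BilinForm ℝ (Fin 7 → ℝ) :=
  LinearMap.mk₂ ℝ
    (fun X Y => ∑ σ : Equiv.Perm (Fin 7), ((Equiv.Perm.sign σ : ℤ) : ℝ) *
      (Ω ![X, b (σ 0), b (σ 1)] * Ω ![Y, b (σ 2), b (σ 3)] * Ω ![b (σ 4), b (σ 5), b (σ 6)]))
    (by
      intro X X' Y
      rw [← Finset.sum_add_distrib]
      refine Finset.sum_congr rfl fun σ _ => ?_
      simp only [← ContinuousAlternatingMap.coe_toAlternatingMap, AlternatingMap.map_vecCons_add]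
      ring)
    (by
      intro c X Y
      rw [smul_eq_mul, Finset.mul_sum]
      refine Finset.sum_congr rfl fun σ _ => ?_
      simp only [← ContinuousAlternatingMap.coe_toAlternatingMap, AlternatingMap.map_vecCons_smul,
        smul_eq_mul]
      ring)
    (by
      intro X Y Y'
      rw [← Finset.sum_add_distrib]
      refine Finset.sum_congr rfl fun σ _ => ?_
      simp only [← ContinuousAlternatingMap.coe_toAlternatingMap, AlternatingMap.map_vecCons_add]
      ring)
    (by
      intro c X Y
      rw [smul_eq_mul, Finset.mul_sum]
      refine Finset.sum_congr rfl fun σ _ => ?_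
      simp only [← ContinuousAlternatingMap.coe_toAlternatingMap, AlternatingMap.map_vecCons_smul,
        smul_eq_mul]
      ring)

/-- A bilinear product on `ℝ⁷` is a cross product relative to the norm (nondegenerate quadratic
form) `X ↦ n(X, X)`, where `n` is symmetric bilinear. -/
structure IsCrossProduct (n : LinearMap.BilinForm ℝ (Fin 7 → ℝ))
    (cross : (Fin 7 → ℝ) →ₗ[ℝ] (Fin 7 → ℝ) →ₗ[ℝ] (Fin 7 → ℝ)) : Prop where
  symm : ∀ X Y, n X Y = n Y X
  nondegenerate : n.Nondegenerate
  orthogonal_left : ∀ X Y, n (cross X Y) X = 0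
  orthogonal_right : ∀ X Y, n (cross X Y) Y = 0
  norm_cross : ∀ X Y, n (cross X Y) (cross X Y) = !![n X X, n X Y; n Y X, n Y Y].det

/-- `n` is the norm associated with the 3-form `Ω`: a nonzero multiple of some `n_{Ω,B}`
for which the product `×` with `n(X × Y, Z) = Ω(X, Y, Z)` is a cross product relative to `n`. -/
def IsAssociatedNorm (Ω : ThreeForm) (n : LinearMap.BilinForm ℝ (Fin 7 → ℝ)) : Prop :=
  (∃ (b : Module.Basis (Fin 7) ℝ (Fin 7 → ℝ)) (c : ℝ), c ≠ 0 ∧ n = c • normForm Ω b) ∧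
  ∃ cross : (Fin 7 → ℝ) →ₗ[ℝ] (Fin 7 → ℝ) →ₗ[ℝ] (Fin 7 → ℝ),
    (∀ X Y Z, n (cross X Y) Z = Ω ![X, Y, Z]) ∧ IsCrossProduct n cross

/-- `n` has signature `(q, p)`: `q` is the number of negative and `p` the number of positive
squares in the diagonal form of `X ↦ n(X, X)`. -/
def HasSignature (n : LinearMap.BilinForm ℝ (Fin 7 → ℝ)) (q p : ℕ) : Prop :=
  sigNeg n.toQuadraticMap = q ∧ sigPos n.toQuadraticMap = p

end

/-!
# Generic 3-forms on `ℝ⁷`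

Every form considered is compared with `stdForm ε`, the 3-form `n(x × y, z)` of the imaginary
octonions (`ε = 1`) or split octonions (`ε = -1`); `Omega1 e` lies in the orbit of the first and
`Omega0` in the orbit of the second.

The form `n_{Ω,B}` depends on `B` only through a determinant factor, so it suffices to work with its
value `n_Ω` for the canonical basis, which is `GL(7)`-equivariant up to the determinant
(`stdNorm_glAct`). The argument then rests on four facts.

* The orbit of `stdForm 1` is open (`isGeneric_stdForm_one`), since the infinitesimal action of
  `GL(7)` at this point is onto; an explicit right inverse is a combination of contractions with
  the form itself.
* Up to a scalar, `n_Ω` makes the product dual to `Ω` a cross product whenever `n_Ω` is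
  nondegenerate. After clearing denominators and taking a cube this is a polynomial identity in `Ω`.
  It holds at `stdForm 1` by direct computation, hence on its orbit by equivariance, hence
  everywhere because that orbit is open (`contractNorm_pow_three`). The scalar is a real ninth root
  (`exists_isAssociatedNorm`).
* A cross product on `ℝ⁷` has a Cayley–Dickson basis (`IsCrossProduct.exists_cayleyDickson`), in
  which the 3-form is `stdForm ε` and the norm has Gram matrix `diag (1, 1, 1, ε, ε, ε, ε)`. So the
  forms with nondegenerate `n_Ω` make up just two orbits, and the signature can be read off.
* Whether `n_Ω` is definite or indefinite separates these orbits and shows that the second is also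
  open (`isGeneric_stdForm_neg_one`). A generic form has nondegenerate `n_Ω`, as otherwise the
  nonzero polynomial `det n_Ω` would vanish on an open set.

Two associated norms of one form are proportional, with a factor whose cube is `1`.
-/

noncomputable section

open scoped Topology

/-! ### The form `n_{Ω,B}` under a change of basis -/

namespace ThreeForm

theorem map_add_left (Ω : ThreeForm) (a b c d : Fin 7 → ℝ) :
    Ω ![a + b, c, d] = Ω ![a, c, d] + Ω ![b, c, d] :=
  Ω.toAlternatingMap.map_vecCons_add ![c, d] a b

theorem map_smul_left (Ω : ThreeForm) (r : ℝ) (a c d : Fin 7 → ℝ) :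
    Ω ![r • a, c, d] = r * Ω ![a, c, d] :=
  Ω.toAlternatingMap.map_vecCons_smul ![c, d] r a

theorem swap_left (Ω : ThreeForm) (a b c : Fin 7 → ℝ) : Ω ![a, b, c] = -Ω ![b, a, c] := by
  have h := Ω.toAlternatingMap.map_swap ![b, a, c] (show (0 : Fin 3) ≠ 1 by decide)
  have e : ![b, a, c] ∘ Equiv.swap (0 : Fin 3) 1 = ![a, b, c] := by
    ext i j; fin_cases i <;> rfl
  rw [e] at h
  exact h

theorem swap_right (Ω : ThreeForm) (a b c : Fin 7 → ℝ) : Ω ![a, b, c] = -Ω ![a, c, b] := by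
  have h := Ω.toAlternatingMap.map_swap ![a, c, b] (show (1 : Fin 3) ≠ 2 by decide)
  have e : ![a, c, b] ∘ Equiv.swap (1 : Fin 3) 2 = ![a, b, c] := by
    ext i j; fin_cases i <;> rfl
  rw [e] at h
  exact h

theorem map_add_mid (Ω : ThreeForm) (a b c d : Fin 7 → ℝ) :
    Ω ![c, a + b, d] = Ω ![c, a, d] + Ω ![c, b, d] := by
  rw [swap_left, map_add_left, swap_left Ω a, swap_left Ω b]; ring

theorem map_smul_mid (Ω : ThreeForm) (r : ℝ) (a c d : Fin 7 → ℝ) :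
    Ω ![c, r • a, d] = r * Ω ![c, a, d] := by
  rw [swap_left, map_smul_left, swap_left Ω a]; ring

theorem map_add_right (Ω : ThreeForm) (a b c d : Fin 7 → ℝ) :
    Ω ![c, d, a + b] = Ω ![c, d, a] + Ω ![c, d, b] := by
  rw [swap_right, map_add_mid, swap_right Ω c a, swap_right Ω c b]; ring

theorem map_smul_right (Ω : ThreeForm) (r : ℝ) (a c d : Fin 7 → ℝ) :
    Ω ![c, d, r • a] = r * Ω ![c, d, a] := by
  rw [swap_right, map_smul_mid, swap_right Ω c a]; ring

theorem self_left (Ω : ThreeForm) (a b : Fin 7 → ℝ) : Ω ![a, a, b] = 0 := by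
  linarith [swap_left Ω a a b]

theorem self_right (Ω : ThreeForm) (a b : Fin 7 → ℝ) : Ω ![a, b, b] = 0 := by
  linarith [swap_right Ω a b b]

theorem self_outer (Ω : ThreeForm) (a b : Fin 7 → ℝ) : Ω ![a, b, a] = 0 := by
  rw [swap_right, self_left, neg_zero]

end ThreeForm

/-- The 7-linear map whose alternatization, evaluated at a basis `b`, is `n_{Ω,b}(X, Y)`. -/
def normMultilinear (Ω : ThreeForm) (X Y : Fin 7 → ℝ) :
    MultilinearMap ℝ (fun _ : Fin 7 => Fin 7 → ℝ) ℝ where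
  toFun v := Ω ![X, v 0, v 1] * Ω ![Y, v 2, v 3] * Ω ![v 4, v 5, v 6]
  map_update_add' := by
    intro inst v i x y
    obtain rfl : inst = instDecidableEqFin 7 := Subsingleton.elim _ _
    fin_cases i <;>
      simp [Function.update, ThreeForm.map_add_left, ThreeForm.map_add_mid,
        ThreeForm.map_add_right] <;> ring
  map_update_smul' := by
    intro inst v i c x
    obtain rfl : inst = instDecidableEqFin 7 := Subsingleton.elim _ _
    fin_cases i <;>
      simp [Function.update, ThreeForm.map_smul_left, ThreeForm.map_smul_mid,
        ThreeForm.map_smul_right] <;> ring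

theorem alternatization_normMultilinear (Ω : ThreeForm) (X Y : Fin 7 → ℝ)
    (b : Module.Basis (Fin 7) ℝ (Fin 7 → ℝ)) :
    MultilinearMap.alternatization (normMultilinear Ω X Y) b = normForm Ω b X Y := by
  rw [MultilinearMap.alternatization_apply]
  simp only [normForm, LinearMap.mk₂_apply]
  refine Finset.sum_congr rfl fun σ _ => ?_
  rw [Units.smul_def, zsmul_eq_mul]
  rfl

theorem normForm_eq_det_mul (Ω : ThreeForm) (b b' : Module.Basis (Fin 7) ℝ (Fin 7 → ℝ))
    (X Y : Fin 7 → ℝ) : normForm Ω b' X Y = b.det b' * normForm Ω b X Y := by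
  rw [← alternatization_normMultilinear, ← alternatization_normMultilinear]
  have h := DFunLike.congr_fun
    (AlternatingMap.eq_smul_basis_det b (MultilinearMap.alternatization (normMultilinear Ω X Y)))
    (b' : Fin 7 → Fin 7 → ℝ)
  rw [h, AlternatingMap.smul_apply, smul_eq_mul, mul_comm]

/-- The symmetric form `n_{Ω,B}` for the canonical basis `B`. -/
def stdNorm (Ω : ThreeForm) : LinearMap.BilinForm ℝ (Fin 7 → ℝ) :=
  normForm Ω (Pi.basisFun ℝ (Fin 7))

/-- All the forms `n_{Ω,B}` of one 3-form are proportional. -/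
theorem exists_normForm_eq_smul_stdNorm (Ω : ThreeForm)
    (b : Module.Basis (Fin 7) ℝ (Fin 7 → ℝ)) :
    ∃ c : ℝ, c ≠ 0 ∧ normForm Ω b = c • stdNorm Ω :=
  ⟨(Pi.basisFun ℝ (Fin 7)).det b, ((Pi.basisFun ℝ (Fin 7)).isUnit_det b).ne_zero, by
    ext X Y; simp only [LinearMap.coe_comp, Function.comp_apply]
    exact normForm_eq_det_mul _ _ _ _ _⟩

theorem comp_apply_three (Ω : ThreeForm) (A : (Fin 7 → ℝ) →L[ℝ] (Fin 7 → ℝ))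
    (X Y Z : Fin 7 → ℝ) :
    Ω.compContinuousLinearMap A ![X, Y, Z] = Ω ![A X, A Y, A Z] := by
  rw [ContinuousAlternatingMap.compContinuousLinearMap_apply]
  congr 1
  ext i j; fin_cases i <;> rfl

theorem glAct_apply_three (f : (Fin 7 → ℝ) ≃L[ℝ] (Fin 7 → ℝ)) (Ω : ThreeForm)
    (X Y Z : Fin 7 → ℝ) : glAct f Ω ![X, Y, Z] = Ω ![f.symm X, f.symm Y, f.symm Z] :=
  comp_apply_three _ _ _ _ _

/-- The form `n_Ω` is `GL(7)`-equivariant up to the factor `det f⁻¹`. -/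
theorem stdNorm_glAct (f : (Fin 7 → ℝ) ≃L[ℝ] (Fin 7 → ℝ)) (Ω : ThreeForm)
    (X Y : Fin 7 → ℝ) :
    stdNorm (glAct f Ω) X Y =
      LinearMap.det (f.symm.toLinearEquiv : (Fin 7 → ℝ) →ₗ[ℝ] (Fin 7 → ℝ)) *
        stdNorm Ω (f.symm X) (f.symm Y) := by
  have h : stdNorm (glAct f Ω) X Y =
      normForm Ω ((Pi.basisFun ℝ (Fin 7)).map f.symm.toLinearEquiv) (f.symm X) (f.symm Y) := by
    simp only [stdNorm, normForm, LinearMap.mk₂_apply, glAct_apply_three, Module.Basis.map_apply]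
    rfl
  rw [h, normForm_eq_det_mul Ω (Pi.basisFun ℝ (Fin 7))]
  congr 1
  have := (Pi.basisFun ℝ (Fin 7)).det_comp
    (f.symm.toLinearEquiv : (Fin 7 → ℝ) →ₗ[ℝ] (Fin 7 → ℝ)) (Pi.basisFun ℝ (Fin 7))
  rw [Module.Basis.det_self, mul_one] at this
  rw [← this]
  rfl

theorem stdNorm_symm (Ω : ThreeForm) (X Y : Fin 7 → ℝ) : stdNorm Ω X Y = stdNorm Ω Y X := by
  simp only [stdNorm, normForm, LinearMap.mk₂_apply]
  -- exchange the first two pairs of arguments, an even permutation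
  let τ : Equiv.Perm (Fin 7) := Equiv.swap 0 2 * Equiv.swap 1 3
  have hτ : Equiv.Perm.sign τ = 1 := by decide
  refine Fintype.sum_equiv (Equiv.mulRight τ) _ _ fun σ => ?_
  simp only [Equiv.coe_mulRight, Equiv.Perm.sign_mul, hτ, mul_one, Equiv.Perm.mul_apply]
  have h0 : τ 0 = 2 := by decide
  have h1 : τ 1 = 3 := by decide
  have h2 : τ 2 = 0 := by decide
  have h3 : τ 3 = 1 := by decide
  have h4 : τ 4 = 4 := by decide
  have h5 : τ 5 = 5 := by decide
  have h6 : τ 6 = 6 := by decide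
  rw [h0, h1, h2, h3, h4, h5, h6]
  ring

/-- The Gram matrix of `n_Ω` in the canonical basis. -/
def normMatrix (Ω : ThreeForm) : Matrix (Fin 7) (Fin 7) ℝ :=
  Matrix.of fun a b => stdNorm Ω (Pi.single a 1) (Pi.single b 1)

theorem stdNorm_eq_dotProduct (Ω : ThreeForm) (X Y : Fin 7 → ℝ) :
    stdNorm Ω X Y = X ⬝ᵥ (normMatrix Ω).mulVec Y := by
  have h : LinearMap.toMatrix₂' ℝ (stdNorm Ω) = normMatrix Ω := by
    ext a b; rw [LinearMap.toMatrix₂'_apply]; rfl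
  rw [← h, ← Matrix.toLinearMap₂'_apply', Matrix.toLinearMap₂'_toMatrix']

theorem normMatrix_glAct (f : (Fin 7 → ℝ) ≃L[ℝ] (Fin 7 → ℝ)) (Ω : ThreeForm)
    (A : Matrix (Fin 7) (Fin 7) ℝ) (hA : ∀ X, f.symm X = A.mulVec X) :
    normMatrix (glAct f Ω) = A.det • (A.transpose * normMatrix Ω * A) := by
  have hA' : LinearMap.toMatrix' (f.symm.toLinearEquiv : (Fin 7 → ℝ) →ₗ[ℝ] (Fin 7 → ℝ)) = A := by
    apply Matrix.toLin'.injective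
    ext1 i
    ext1
    rw [Matrix.toLin'_toMatrix', LinearMap.comp_apply, LinearMap.comp_apply, Matrix.toLin'_apply,
      ← hA]
    rfl
  ext a b
  have : normMatrix (glAct f Ω) a b = stdNorm (glAct f Ω) (Pi.single a 1) (Pi.single b 1) := rfl
  rw [this, stdNorm_glAct, ← LinearMap.det_toMatrix', hA', stdNorm_eq_dotProduct, hA, hA,
    Matrix.smul_apply, smul_eq_mul]
  congr 1
  rw [Matrix.mulVec_mulVec, Matrix.dotProduct_mulVec, Matrix.vecMul_mulVec,
    ← Matrix.dotProduct_mulVec, ← Matrix.mul_assoc]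
  simp

/-! ### The two standard forms and their norms -/

/-- The standard form `e⁰¹² + ε (e⁰³⁶ + e¹⁴⁶ + e²⁵⁶ - e⁰⁴⁵ + e¹³⁵ - e²³⁴)`: the cross product
3-form of the octonions for `ε = 1` and of the split octonions for `ε = -1`. -/
def stdForm (ε : ℤˣ) : ThreeForm :=
  wedge3 (coord7 0) (coord7 1) (coord7 2) + ((ε : ℤ) : ℝ) •
    (wedge3 (coord7 0) (coord7 3) (coord7 6) + wedge3 (coord7 1) (coord7 4) (coord7 6)
      + wedge3 (coord7 2) (coord7 5) (coord7 6) - wedge3 (coord7 0) (coord7 4) (coord7 5)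
      + wedge3 (coord7 1) (coord7 3) (coord7 5) - wedge3 (coord7 2) (coord7 3) (coord7 4))

/-- The third point on the line through two distinct points of the Fano plane whose lines are the
monomials of `stdForm`. The diagonal values play no role. -/
def fanoThird : Fin 7 → Fin 7 → Fin 7 :=
  ![![0, 2, 1, 6, 5, 4, 3], ![2, 1, 0, 5, 6, 3, 4], ![1, 0, 2, 4, 3, 6, 5], ![6, 5, 4, 3, 2, 1, 0],
    ![5, 6, 3, 2, 4, 0, 1], ![4, 3, 6, 1, 0, 5, 2], ![3, 4, 5, 0, 1, 2, 6]]

/-- The values of `stdForm ε` on the canonical basis, as a table that can be evaluated. -/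
def stdTable (ε : ℤ) (a b c : Fin 7) : ℤ :=
  if fanoThird a b = c then
    ![![0, 1, -1, ε, -ε, ε, -ε], ![-1, 0, 1, ε, ε, -ε, -ε], ![1, -1, 0, -ε, ε, ε, -ε],
      ![-ε, -ε, ε, 0, -ε, ε, ε], ![ε, -ε, -ε, ε, 0, -ε, ε], ![-ε, ε, -ε, -ε, ε, 0, ε],
      ![ε, ε, ε, -ε, -ε, -ε, 0]] a b
  else 0

/-- The values of a decomposable form on the canonical basis, by the rule of Sarrus. -/
def wedgeTable (p q r a b c : Fin 7) : ℤ :=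
  let d : Fin 7 → Fin 7 → ℤ := fun x y => if y = x then 1 else 0
  d a p * d b q * d c r - d a p * d b r * d c q - d a q * d b p * d c r + d a q * d b r * d c p +
    d a r * d b p * d c q - d a r * d b q * d c p

theorem wedge3_coord7_single (p q r a b c : Fin 7) :
    wedge3 (coord7 p) (coord7 q) (coord7 r) ![Pi.single a 1, Pi.single b 1, Pi.single c 1] =
      (wedgeTable p q r a b c : ℝ) := by
  rw [wedge3_apply, Matrix.det_fin_three]
  simp [wedgeTable, coord7, Pi.single_apply]

set_option maxRecDepth 10000 in
theorem wedgeTable_sum_eq_stdTable : ∀ (ε : ℤˣ) (a b c : Fin 7),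
    wedgeTable 0 1 2 a b c + ε * (wedgeTable 0 3 6 a b c + wedgeTable 1 4 6 a b c
      + wedgeTable 2 5 6 a b c - wedgeTable 0 4 5 a b c + wedgeTable 1 3 5 a b c
      - wedgeTable 2 3 4 a b c) = stdTable ε a b c := by
  decide +kernel

theorem stdForm_single (ε : ℤˣ) (a b c : Fin 7) :
    stdForm ε ![Pi.single a 1, Pi.single b 1, Pi.single c 1] = (stdTable ε a b c : ℝ) := by
  rw [← wedgeTable_sum_eq_stdTable]
  simp [stdForm, wedge3_coord7_single]

/-- Expansion of a signed sum over permutations along the image of `0`. -/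
theorem sum_perm_fin_succ {α : Type*} (n : ℕ) (F : (Fin (n + 1) → α) → ℤ) (v : Fin (n + 1) → α) :
    ∑ σ : Equiv.Perm (Fin (n + 1)), (Equiv.Perm.sign σ : ℤ) * F (v ∘ σ) =
      ∑ p : Fin (n + 1), (if p = 0 then 1 else -1) * ∑ τ : Equiv.Perm (Fin n),
        (Equiv.Perm.sign τ : ℤ) *
          F (Fin.cons (v p) ((fun i => v (Equiv.swap 0 p i.succ)) ∘ τ)) := by
  rw [← Equiv.Perm.decomposeFin.symm.sum_comp, Fintype.sum_prod_type]
  refine Finset.sum_congr rfl fun p _ => ?_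
  rw [Finset.mul_sum]
  refine Finset.sum_congr rfl fun τ _ => ?_
  rw [Equiv.Perm.decomposeFin.symm_sign, Units.val_mul, mul_assoc]
  congr 1
  · split <;> rfl
  · congr 2
    ext i
    refine Fin.cases ?_ (fun j => ?_) i <;> simp

/-- The signed sum of `F (v ∘ σ)` over all permutations `σ`, by recursion on the value of `σ` at
`0`; unlike the sum over `Equiv.Perm (Fin n)` it evaluates quickly. -/
def altSum {α : Type*} : (n : ℕ) → ((Fin n → α) → ℤ) → (Fin n → α) → ℤ
  | 0, F, v => F v
  | n + 1, F, v => ∑ p : Fin (n + 1), (if p = 0 then 1 else -1) *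
      altSum n (fun u => F (Fin.cons (v p) u)) fun i => v (Equiv.swap 0 p i.succ)

theorem altSum_eq_sum_perm {α : Type*} (n : ℕ) (F : (Fin n → α) → ℤ) (v : Fin n → α) :
    altSum n F v = ∑ σ : Equiv.Perm (Fin n), (Equiv.Perm.sign σ : ℤ) * F (v ∘ σ) := by
  induction n with
  | zero => simp [altSum]
  | succ n ih => rw [altSum, sum_perm_fin_succ]; simp only [ih]

/-- Multiplication of integers that does not evaluate its second factor when the first vanishes. -/
def lazyMul (x y : ℤ) : ℤ := if x = 0 then 0 else x * y

theorem lazyMul_eq (x y : ℤ) : lazyMul x y = x * y := by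
  unfold lazyMul; split <;> simp_all

/-- Two steps of the recursion for `altSum`. -/
def altSumPair {α : Type*} {n : ℕ} (F : α → α → (Fin n → α) → ℤ) (v : Fin (n + 2) → α) : ℤ :=
  ∑ p : Fin (n + 2), (if p = 0 then 1 else -1) * ∑ q : Fin (n + 1), (if q = 0 then 1 else -1) *
    F (v p) (v (Equiv.swap 0 p q.succ)) fun i => v (Equiv.swap 0 p (Equiv.swap 0 q i.succ).succ)

theorem altSum_mul_eq_altSumPair {α : Type*} (n : ℕ) (x : α → α → ℤ) (F : (Fin n → α) → ℤ)
    (v : Fin (n + 2) → α) :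
    altSum (n + 2) (fun v => x (v 0) (v 1) * F (fun i => v i.succ.succ)) v =
      altSumPair (fun p q u => lazyMul (x p q) (altSum n F u)) v := by
  simp only [altSum, altSumPair, lazyMul_eq]
  refine Finset.sum_congr rfl fun p _ => ?_
  congr 1
  refine Finset.sum_congr rfl fun q _ => ?_
  congr 1
  rw [altSum_eq_sum_perm, altSum_eq_sum_perm, Finset.mul_sum]
  refine Finset.sum_congr rfl fun σ _ => ?_
  rw [mul_left_comm]
  rfl

/-- `n_Ω(e_a, e_b)` for `Ω = stdForm ε`, arranged so that it can be evaluated. -/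
def stdNormTable (ε : ℤ) (a b : Fin 7) : ℤ :=
  altSumPair (fun p q v => lazyMul (stdTable ε a p q)
    (altSumPair (fun r s u => lazyMul (stdTable ε b r s)
      (altSum 3 (fun w => stdTable ε (w 0) (w 1) (w 2)) u)) v)) id

theorem stdNorm_stdForm_single (ε : ℤˣ) (a b : Fin 7) :
    stdNorm (stdForm ε) (Pi.single a 1) (Pi.single b 1) = (stdNormTable ε a b : ℝ) := by
  have h : stdNormTable ε a b = altSum 7 (fun v => stdTable ε a (v 0) (v 1) *
      (stdTable ε b (v 2) (v 3) * stdTable ε (v 4) (v 5) (v 6))) id := by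
    rw [stdNormTable]
    simp only [← altSum_mul_eq_altSumPair]
    rfl
  rw [h, altSum_eq_sum_perm]
  simp only [stdNorm, normForm, LinearMap.mk₂_apply, Pi.basisFun_apply, stdForm_single]
  push_cast
  refine Finset.sum_congr rfl fun σ _ => ?_
  simp only [Function.comp_apply, id, mul_assoc]

/-- The norms of the canonical basis vectors for the cross product of `stdForm ε`: `1` three times,
then `ε` four times. -/
def stdSign (ε : ℤ) (a : Fin 7) : ℤ := if a.val < 3 then 1 else ε

set_option maxRecDepth 100000 in
theorem stdNormTable_eq : ∀ (ε : ℤˣ) (a b : Fin 7),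
    stdNormTable ε a b = if a = b then -144 * stdSign ε a else 0 := by
  decide +kernel

theorem normMatrix_stdForm (ε : ℤˣ) :
    normMatrix (stdForm ε) = Matrix.diagonal fun a => (-144 : ℝ) * (stdSign ε a : ℤ) := by
  ext a b
  have : normMatrix (stdForm ε) a b =
    stdNorm (stdForm ε) (Pi.single a 1) (Pi.single b 1) := rfl
  rw [this, stdNorm_stdForm_single, stdNormTable_eq, Matrix.diagonal_apply]
  split <;> simp

/-! ### Orbits -/

theorem mem_glOrbit_self {n p : ℕ} (Ω : (Fin n → ℝ) [⋀^Fin p]→L[ℝ] ℝ) : Ω ∈ glOrbit Ω :=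
  ⟨ContinuousLinearEquiv.refl ℝ _, by ext; rfl⟩

theorem glAct_glAct_symm {n p : ℕ} (f : (Fin n → ℝ) ≃L[ℝ] (Fin n → ℝ))
    (Ω : (Fin n → ℝ) [⋀^Fin p]→L[ℝ] ℝ) : glAct f.symm (glAct f Ω) = Ω := by
  ext v; simp [glAct, Function.comp_def]

theorem glAct_mem_glOrbit_iff {n p : ℕ} (f : (Fin n → ℝ) ≃L[ℝ] (Fin n → ℝ))
    (Ω Ω' : (Fin n → ℝ) [⋀^Fin p]→L[ℝ] ℝ) : glAct f Ω' ∈ glOrbit Ω ↔ Ω' ∈ glOrbit Ω := by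
  have key : ∀ (f : (Fin n → ℝ) ≃L[ℝ] (Fin n → ℝ)) (Ω' : (Fin n → ℝ) [⋀^Fin p]→L[ℝ] ℝ),
      Ω' ∈ glOrbit Ω → glAct f Ω' ∈ glOrbit Ω := by
    rintro f _ ⟨g, rfl⟩
    exact ⟨g.trans f, by ext v; rfl⟩
  refine ⟨fun h => ?_, key f Ω'⟩
  have := key f.symm _ h
  rwa [glAct_glAct_symm] at this

theorem glOrbit_eq_of_mem {n p : ℕ} {Ω Ω' : (Fin n → ℝ) [⋀^Fin p]→L[ℝ] ℝ}
    (h : Ω' ∈ glOrbit Ω) : glOrbit Ω' = glOrbit Ω := by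
  obtain ⟨f, rfl⟩ := h
  ext Ω''
  constructor
  · rintro ⟨g, rfl⟩
    exact (glAct_mem_glOrbit_iff g _ _).2 ((glAct_mem_glOrbit_iff f _ _).2 (mem_glOrbit_self Ω))
  · rintro ⟨g, rfl⟩
    refine (glAct_mem_glOrbit_iff g _ _).2 ?_
    rw [← glAct_mem_glOrbit_iff f]
    exact mem_glOrbit_self _

theorem continuous_glAct {n p : ℕ} (f : (Fin n → ℝ) ≃L[ℝ] (Fin n → ℝ)) :
    Continuous (glAct f : ((Fin n → ℝ) [⋀^Fin p]→L[ℝ] ℝ) → _) :=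
  (ContinuousAlternatingMap.compContinuousLinearMapCLM
    (f.symm : (Fin n → ℝ) →L[ℝ] (Fin n → ℝ))).continuous

theorem isGeneric_of_mem_nhds {n p : ℕ} {Ω : (Fin n → ℝ) [⋀^Fin p]→L[ℝ] ℝ}
    (h : glOrbit Ω ∈ 𝓝 Ω) : IsGeneric Ω := by
  rw [IsGeneric, isOpen_iff_mem_nhds]
  rintro _ ⟨f, rfl⟩
  have h' : glAct f.symm ⁻¹' glOrbit Ω = glOrbit Ω := by
    ext Ω'; exact glAct_mem_glOrbit_iff _ _ _
  rw [← h']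
  apply (continuous_glAct f.symm).continuousAt.preimage_mem_nhds
  rwa [show glAct f.symm (glAct f Ω) = Ω from glAct_glAct_symm f Ω]

/-! ### Forms in coordinates -/

/-- A property of triples that is invariant under permutations and holds for repeated entries need
only be checked on increasing triples. -/
theorem forall_triple_of_sorted {P : Fin 7 → Fin 7 → Fin 7 → Prop}
    (h₁ : ∀ a b c, P a b c → P b a c) (h₂ : ∀ a b c, P a b c → P a c b) (h₀ : ∀ a b, P a a b)
    (h : ∀ a b c, a < b → b < c → P a b c) (a b c : Fin 7) : P a b c := by
  have h₃ : ∀ a b, P a b b := fun a b => h₁ _ _ _ (h₂ _ _ _ (h₀ b a))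
  have h₄ : ∀ a b, P a b a := fun a b => h₂ _ _ _ (h₀ a b)
  rcases lt_trichotomy a b with hab | hab | hab <;>
    rcases lt_trichotomy b c with hbc | hbc | hbc <;>
    rcases lt_trichotomy a c with hac | hac | hac <;> grind

namespace ThreeForm

theorem eq_sum_left (Ω : ThreeForm) (X Y Z : Fin 7 → ℝ) :
    Ω ![X, Y, Z] = ∑ m, X m * Ω ![Pi.single m 1, Y, Z] := by
  have := LinearMap.pi_apply_eq_sum_univ (IsLinearMap.mk' (fun X => Ω ![X, Y, Z])
    ⟨fun a b => Ω.map_add_left a b Y Z, fun r a => Ω.map_smul_left r a Y Z⟩) X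
  have e : ∀ m : Fin 7, (fun j => if m = j then (1 : ℝ) else 0) = Pi.single m 1 := fun m => by
    ext j; simp [Pi.single_apply, eq_comm]
  simpa only [e, IsLinearMap.mk'_apply, smul_eq_mul] using this

theorem eq_sum_mid (Ω : ThreeForm) (X Y Z : Fin 7 → ℝ) :
    Ω ![X, Y, Z] = ∑ m, Y m * Ω ![X, Pi.single m 1, Z] := by
  rw [swap_left, eq_sum_left, ← Finset.sum_neg_distrib]
  exact Finset.sum_congr rfl fun m _ => by rw [swap_left]; ring

theorem eq_sum_right (Ω : ThreeForm) (X Y Z : Fin 7 → ℝ) :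
    Ω ![X, Y, Z] = ∑ m, Z m * Ω ![X, Y, Pi.single m 1] := by
  rw [swap_right, eq_sum_mid, ← Finset.sum_neg_distrib]
  exact Finset.sum_congr rfl fun m _ => by rw [swap_right]; ring

/-- Two 3-forms agree as soon as they agree on increasing triples of a basis. -/
theorem ext_sorted {Ω Ω' : ThreeForm} (b : Module.Basis (Fin 7) ℝ (Fin 7 → ℝ))
    (h : ∀ i j k, i < j → j < k → Ω ![b i, b j, b k] = Ω' ![b i, b j, b k]) : Ω = Ω' := by
  have h' : ∀ i j k, Ω ![b i, b j, b k] = Ω' ![b i, b j, b k] := by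
    apply forall_triple_of_sorted _ _ _ h
    · intro i j k hi; rw [swap_left, hi, ← swap_left]
    · intro i j k hi; rw [swap_right, hi, ← swap_right]
    · intro i j; rw [self_left, self_left]
  apply ContinuousAlternatingMap.toAlternatingMap_injective
  refine b.ext_alternating fun v _ => ?_
  have hv : (fun i => b (v i)) = ![b (v 0), b (v 1), b (v 2)] := by
    ext i j; fin_cases i <;> rfl
  rw [hv]
  exact h' _ _ _

end ThreeForm

/-! ### The orbit of the compact standard form is open -/

/-- Six times the matrix of an element of `gl(7)` moving `stdForm 1` in the direction
`eᵖ ∧ eᵠ ∧ eʳ`. It is a combination of the contraction of the two 3-forms over two indices, its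
transpose and its trace, with coefficients determined by the three nontrivial irreducible
`G₂`-summands of `∧³`. -/
def liftTable (p q r a b : Fin 7) : ℤ :=
  let φ := stdTable 1
  let d : Fin 7 → Fin 7 → ℤ := fun x y => if x = y then 1 else 0
  let c : Fin 7 → Fin 7 → ℤ := fun a b =>
    lazyMul (d a p) (φ b q r) + lazyMul (d a q) (φ b r p) + lazyMul (d a r) (φ b p q)
  c a b + 2 * c b a - lazyMul (d a b) (φ p q r)

set_option maxRecDepth 100000 in
theorem liftTable_spec : ∀ p q r : Fin 7, p < q → q < r → ∀ i j k : Fin 7, i < j → j < k →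
    ∑ m, lazyMul (stdTable 1 m j k) (liftTable p q r m i) +
      ∑ m, lazyMul (stdTable 1 i m k) (liftTable p q r m j) +
      ∑ m, lazyMul (stdTable 1 i j m) (liftTable p q r m k) = 6 * wedgeTable p q r i j k := by
  decide +kernel

theorem eq_top_of_sorted_wedge3_mem (S : Submodule ℝ ThreeForm)
    (h : ∀ p q r, p < q → q < r → wedge3 (coord7 p) (coord7 q) (coord7 r) ∈ S) : S = ⊤ := by
  have swap₁ : ∀ p q r, wedge3 (coord7 q) (coord7 p) (coord7 r) =
      -wedge3 (coord7 p) (coord7 q) (coord7 r) := fun p q r => by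
    ext x; simp only [ContinuousAlternatingMap.neg_apply, wedge3_apply, Matrix.det_fin_three]
    simp; ring
  have swap₂ : ∀ p q r, wedge3 (coord7 p) (coord7 r) (coord7 q) =
      -wedge3 (coord7 p) (coord7 q) (coord7 r) := fun p q r => by
    ext x; simp only [ContinuousAlternatingMap.neg_apply, wedge3_apply, Matrix.det_fin_three]
    simp; ring
  have diag : ∀ p q, wedge3 (coord7 p) (coord7 p) (coord7 q) = 0 := fun p q => by
    ext x; rw [wedge3_apply, Matrix.det_fin_three]
    simp
  have all : ∀ p q r, wedge3 (coord7 p) (coord7 q) (coord7 r) ∈ S := by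
    apply forall_triple_of_sorted _ _ _ h
    · intro p q r hm; rw [swap₁]; exact S.neg_mem hm
    · intro p q r hm; rw [swap₂]; exact S.neg_mem hm
    · intro p q; rw [diag]; exact S.zero_mem
  refine eq_top_iff.2 fun ω _ => ?_
  have hω : ω = ∑ p, ∑ q, ∑ r,
      ((1 / 6 : ℝ) * ω ![Pi.single p 1, Pi.single q 1, Pi.single r 1]) •
        wedge3 (coord7 p) (coord7 q) (coord7 r) := by
    refine ThreeForm.ext_sorted (Pi.basisFun ℝ (Fin 7)) fun i j k _ _ => ?_
    simp only [Pi.basisFun_apply, ContinuousAlternatingMap.sum_apply,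
      ContinuousAlternatingMap.smul_apply, wedge3_coord7_single, wedgeTable, smul_eq_mul]
    set w : Fin 7 → Fin 7 → Fin 7 → ℝ :=
      fun a b c => ω ![Pi.single a 1, Pi.single b 1, Pi.single c 1] with hw
    have h₁ : ∀ a b c, w a b c = -w b a c := fun a b c => ω.swap_left _ _ _
    have h₂ : ∀ a b c, w a b c = -w a c b := fun a b c => ω.swap_right _ _ _
    change w i j k = ∑ p, ∑ q, ∑ r, (1 / 6 : ℝ) * w p q r * _
    push_cast
    simp only [mul_add, mul_sub, Finset.sum_add_distrib, Finset.sum_sub_distrib, mul_ite,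
      mul_one, mul_zero, Finset.sum_ite_eq', Finset.mem_univ, if_true]
    simp
    linarith [h₁ i j k, h₂ i j k, h₁ i k j, h₂ j i k, h₁ k j i, h₂ k i j, h₁ k i j, h₂ k j i]
  rw [hω]
  exact S.sum_mem fun p _ => S.sum_mem fun q _ => S.sum_mem fun r _ => S.smul_mem _ (all p q r)

theorem fderivCompContinuousLinearMap_id_apply (Ω : ThreeForm)
    (B : (Fin 7 → ℝ) →L[ℝ] (Fin 7 → ℝ)) (X Y Z : Fin 7 → ℝ) :
    Ω.fderivCompContinuousLinearMap (ContinuousLinearMap.id ℝ (Fin 7 → ℝ)) B ![X, Y, Z] =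
      Ω ![B X, Y, Z] + Ω ![X, B Y, Z] + Ω ![X, Y, B Z] := by
  rw [ContinuousAlternatingMap.fderivCompContinuousLinearMap_apply, Fin.sum_univ_three]
  congr 2
  · congr 2
    ext i j; fin_cases i <;> rfl
  · congr 2
    ext i j; fin_cases i <;> rfl
  · ext i j; fin_cases i <;> rfl

/-- The infinitesimal action of `GL(7)` at `stdForm 1` is onto. -/
theorem range_fderiv_stdForm_one :
    ((stdForm 1).fderivCompContinuousLinearMap
      (ContinuousLinearMap.id ℝ (Fin 7 → ℝ))).range = ⊤ := by
  refine eq_top_of_sorted_wedge3_mem _ fun p q r hpq hqr => ?_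
  let B : (Fin 7 → ℝ) →L[ℝ] (Fin 7 → ℝ) := LinearMap.toContinuousLinearMap
    (Matrix.toLin' (Matrix.of fun a b => (1 / 6 : ℝ) * (liftTable p q r a b : ℝ)))
  have hB : ∀ i m, B (Pi.single i 1) m = (1 / 6 : ℝ) * (liftTable p q r m i : ℝ) := fun i m => by
    simp [B]
  refine ⟨B, ThreeForm.ext_sorted (Pi.basisFun ℝ (Fin 7)) fun i j k hij hjk => ?_⟩
  have hs := congrArg (Int.cast (R := ℝ)) (liftTable_spec p q r hpq hqr i j k hij hjk)
  simp only [lazyMul_eq] at hs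
  push_cast at hs
  simp only [Pi.basisFun_apply, ContinuousLinearMap.coe_coe]
  rw [fderivCompContinuousLinearMap_id_apply, ThreeForm.eq_sum_left, ThreeForm.eq_sum_mid _ _ (B _),
    ThreeForm.eq_sum_right _ _ _ (B _), wedge3_coord7_single]
  simp only [stdForm_single, hB]
  have e : ∀ f g : Fin 7 → ℝ, ∑ m, 1 / 6 * f m * g m = 1 / 6 * ∑ m, g m * f m := fun f g => by
    rw [Finset.mul_sum]; exact Finset.sum_congr rfl fun m _ => by ring
  simp only [e, Units.val_one]
  linarith

theorem isGeneric_stdForm_one : IsGeneric (stdForm 1) := by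
  apply isGeneric_of_mem_nhds
  have hd : HasStrictFDerivAt
      (fun g : (Fin 7 → ℝ) →L[ℝ] (Fin 7 → ℝ) => (stdForm 1).compContinuousLinearMap g)
      ((stdForm 1).fderivCompContinuousLinearMap (ContinuousLinearMap.id ℝ (Fin 7 → ℝ)))
      (ContinuousLinearMap.id ℝ (Fin 7 → ℝ)) := by
    have := (hasStrictFDerivAt_const (𝕜 := ℝ) (stdForm 1)
      (ContinuousLinearMap.id ℝ (Fin 7 → ℝ))).continuousAlternatingMapCompContinuousLinearMap
        (hasStrictFDerivAt_id (𝕜 := ℝ) (ContinuousLinearMap.id ℝ (Fin 7 → ℝ)))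
    simpa using this
  have hm := hd.map_nhds_eq_of_surj range_fderiv_stdForm_one
  have hid : (stdForm 1).compContinuousLinearMap (ContinuousLinearMap.id ℝ (Fin 7 → ℝ)) =
      stdForm 1 := by ext; rfl
  rw [hid] at hm
  rw [← hm, Filter.mem_map]
  filter_upwards [(ContinuousLinearEquiv.refl ℝ (Fin 7 → ℝ)).nhds] with g ⟨f, hf⟩
  exact ⟨f.symm, by rw [← hf]; rfl⟩

/-! ### A polynomial identity between a 3-form and its norm -/

/-- The covector `Ω(X, Y, ·)` in coordinates. -/
def contractPair (Ω : ThreeForm) (X Y : Fin 7 → ℝ) : Fin 7 → ℝ :=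
  fun k => Ω ![X, Y, Pi.single k 1]

theorem contractPair_dotProduct (Ω : ThreeForm) (X Y Z : Fin 7 → ℝ) :
    contractPair Ω X Y ⬝ᵥ Z = Ω ![X, Y, Z] := by
  rw [Ω.eq_sum_right]; exact Finset.sum_congr rfl fun k _ => mul_comm _ _

/-- The Gram determinant of `X`, `Y` for `n_Ω`. -/
def normGram (Ω : ThreeForm) (X Y : Fin 7 → ℝ) : ℝ :=
  stdNorm Ω X X * stdNorm Ω Y Y - stdNorm Ω X Y ^ 2

/-- The square of the covector `Ω(X, Y, ·)` for the form dual to `n_Ω`, with denominators cleared: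
the inverse Gram matrix is replaced by the adjugate. -/
def contractNorm (Ω : ThreeForm) (X Y : Fin 7 → ℝ) : ℝ :=
  contractPair Ω X Y ⬝ᵥ (normMatrix Ω).adjugate.mulVec (contractPair Ω X Y)

theorem exists_matrix_symm (f : (Fin 7 → ℝ) ≃L[ℝ] (Fin 7 → ℝ)) :
    ∃ A : Matrix (Fin 7) (Fin 7) ℝ, (∀ X, f.symm X = A.mulVec X) ∧ A.det ≠ 0 := by
  refine ⟨LinearMap.toMatrix' (f.symm.toLinearEquiv : (Fin 7 → ℝ) →ₗ[ℝ] (Fin 7 → ℝ)),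
    fun X => ?_, ?_⟩
  · rw [← Matrix.toLin'_apply, Matrix.toLin'_toMatrix']; rfl
  · rw [LinearMap.det_toMatrix']
    exact (LinearEquiv.isUnit_det' f.symm.toLinearEquiv).ne_zero

theorem normGram_glAct (f : (Fin 7 → ℝ) ≃L[ℝ] (Fin 7 → ℝ)) (Ω : ThreeForm)
    {A : Matrix (Fin 7) (Fin 7) ℝ} (hA : ∀ X, f.symm X = A.mulVec X) (X Y : Fin 7 → ℝ) :
    normGram (glAct f Ω) X Y = A.det ^ 2 * normGram Ω (A.mulVec X) (A.mulVec Y) := by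
  have h : ∀ X Y, stdNorm (glAct f Ω) X Y = A.det * stdNorm Ω (A.mulVec X) (A.mulVec Y) := by
    intro X Y
    rw [stdNorm_eq_dotProduct, normMatrix_glAct f Ω A hA, stdNorm_eq_dotProduct,
      Matrix.smul_mulVec, dotProduct_smul, smul_eq_mul, ← Matrix.mulVec_mulVec,
      ← Matrix.mulVec_mulVec, Matrix.dotProduct_mulVec X A.transpose, Matrix.vecMul_transpose]
  simp only [normGram, h]; ring

theorem contractNorm_glAct (f : (Fin 7 → ℝ) ≃L[ℝ] (Fin 7 → ℝ)) (Ω : ThreeForm)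
    {A : Matrix (Fin 7) (Fin 7) ℝ} (hA : ∀ X, f.symm X = A.mulVec X) (X Y : Fin 7 → ℝ) :
    contractNorm (glAct f Ω) X Y = A.det ^ 8 * contractNorm Ω (A.mulVec X) (A.mulVec Y) := by
  set w := contractPair Ω (A.mulVec X) (A.mulVec Y) with hw
  have hc : contractPair (glAct f Ω) X Y = A.transpose.mulVec w := by
    ext k
    rw [contractPair, glAct_apply_three, hA, hA, hA, ← contractPair_dotProduct, ← hw,
      Matrix.dotProduct_mulVec, Matrix.mulVec_transpose, dotProduct_single, mul_one]
  have h₁ : A * (A.adjugate * (normMatrix Ω).adjugate * A.transpose.adjugate) * A.transpose =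
      A.det ^ 2 • (normMatrix Ω).adjugate := by
    rw [← Matrix.mul_assoc, ← Matrix.mul_assoc, Matrix.mul_adjugate, Matrix.mul_assoc,
      Matrix.adjugate_mul, Matrix.det_transpose]
    simp [smul_smul, sq]
  rw [contractNorm, hc, normMatrix_glAct f Ω A hA, Matrix.adjugate_smul,
    Matrix.adjugate_mul_distrib, Matrix.adjugate_mul_distrib, ← Matrix.mul_assoc,
    Matrix.smul_mulVec, dotProduct_smul, smul_eq_mul, Matrix.mulVec_transpose,
    ← Matrix.dotProduct_mulVec, ← Matrix.mulVec_transpose, Matrix.mulVec_mulVec,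
    Matrix.mulVec_mulVec, h₁, Matrix.smul_mulVec, dotProduct_smul, smul_eq_mul, contractNorm]
  simp only [Fintype.card_fin]
  ring

/-- The identity `|X × Y|² = |X|² |Y|² - ⟨X, Y⟩²` for the octonions, cubed so that both sides pick
up the same power of the determinant under `GL(7)`. The constant comes from `n_Ω = -144 ⟨·, ·⟩`. -/
theorem contractNorm_stdForm_one (X Y : Fin 7 → ℝ) :
    144 ^ 2 * contractNorm (stdForm 1) X Y ^ 3 =
      (normMatrix (stdForm 1)).det ^ 2 * normGram (stdForm 1) X Y ^ 3 := by
  have hM : normMatrix (stdForm 1) = Matrix.diagonal fun _ => (-144 : ℝ) := by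
    rw [normMatrix_stdForm]; congr; ext a; simp [stdSign]
  have hadj : (normMatrix (stdForm 1)).adjugate = Matrix.diagonal fun _ => ((-144 : ℝ) ^ 6) := by
    rw [hM, Matrix.adjugate_diagonal]; congr; ext a; simp
  have hn : ∀ X Y, stdNorm (stdForm 1) X Y = -144 * (X ⬝ᵥ Y) := fun X Y => by
    rw [stdNorm_eq_dotProduct, hM]
    simp [dotProduct, Matrix.mulVec_diagonal, Finset.mul_sum]
    exact Finset.sum_congr rfl fun _ _ => by ring
  have hc : contractNorm (stdForm 1) X Y = (-144) ^ 6 *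
      (contractPair (stdForm 1) X Y ⬝ᵥ contractPair (stdForm 1) X Y) := by
    rw [contractNorm, hadj]
    simp only [dotProduct, Matrix.mulVec_diagonal, Finset.mul_sum]
    exact Finset.sum_congr rfl fun _ _ => by ring
  have hL : contractPair (stdForm 1) X Y ⬝ᵥ contractPair (stdForm 1) X Y =
      (X ⬝ᵥ X) * (Y ⬝ᵥ Y) - (X ⬝ᵥ Y) ^ 2 := by
    simp [contractPair, stdForm, wedge3_apply, coord7, dotProduct, Fin.sum_univ_succ,
      Matrix.det_fin_three, Pi.single_apply]
    ring
  have hd : (normMatrix (stdForm 1)).det = (-144) ^ 7 := by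
    rw [hM, Matrix.det_diagonal]; simp
  rw [hc, hL, hd, normGram, hn, hn, hn]
  ring

theorem analyticAt_apply (v : Fin 3 → Fin 7 → ℝ) (Ω : ThreeForm) :
    AnalyticAt ℝ (fun Ω : ThreeForm => Ω v) Ω :=
  (ContinuousAlternatingMap.apply ℝ (Fin 7 → ℝ) ℝ v).analyticAt Ω

theorem analyticAt_stdNorm (X Y : Fin 7 → ℝ) (Ω : ThreeForm) :
    AnalyticAt ℝ (fun Ω : ThreeForm => stdNorm Ω X Y) Ω := by
  simp only [stdNorm, normForm, LinearMap.mk₂_apply]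
  exact Finset.analyticAt_fun_sum _ fun σ _ => analyticAt_const.mul
    (((analyticAt_apply _ _).mul (analyticAt_apply _ _)).mul (analyticAt_apply _ _))

theorem analyticAt_matrix_det {E : Type*} [NormedAddCommGroup E] [NormedSpace ℝ E] {n : ℕ}
    {M : E → Matrix (Fin n) (Fin n) ℝ} {x : E}
    (h : ∀ i j, AnalyticAt ℝ (fun y => M y i j) x) : AnalyticAt ℝ (fun y => (M y).det) x := by
  simp only [Matrix.det_apply']
  exact Finset.analyticAt_fun_sum _ fun σ _ => analyticAt_const.mul
    (Finset.analyticAt_fun_prod _ fun i _ => h _ _)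

theorem analyticAt_det_normMatrix (Ω : ThreeForm) :
    AnalyticAt ℝ (fun Ω => (normMatrix Ω).det) Ω :=
  analyticAt_matrix_det fun _ _ => analyticAt_stdNorm _ _ _

theorem analyticAt_contractNorm (X Y : Fin 7 → ℝ) (Ω : ThreeForm) :
    AnalyticAt ℝ (fun Ω => contractNorm Ω X Y) Ω := by
  simp only [contractNorm, dotProduct, Matrix.mulVec]
  refine Finset.analyticAt_fun_sum _ fun k _ => (analyticAt_apply _ _).mul
    (Finset.analyticAt_fun_sum _ fun l _ => AnalyticAt.mul ?_ (analyticAt_apply _ _))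
  simp only [Matrix.adjugate_apply]
  refine analyticAt_matrix_det fun i j => ?_
  simp only [Matrix.updateRow_apply]
  split
  · exact analyticAt_const
  · exact analyticAt_stdNorm _ _ _

theorem analyticAt_normGram (X Y : Fin 7 → ℝ) (Ω : ThreeForm) :
    AnalyticAt ℝ (fun Ω => normGram Ω X Y) Ω :=
  ((analyticAt_stdNorm _ _ _).mul (analyticAt_stdNorm _ _ _)).sub ((analyticAt_stdNorm _ _ _).pow 2)

/-- The polynomial form of the cross product identity holds for every 3-form, because it holds on
the open orbit of `stdForm 1`. -/
theorem contractNorm_pow_three (Ω : ThreeForm) (X Y : Fin 7 → ℝ) :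
    144 ^ 2 * contractNorm Ω X Y ^ 3 = (normMatrix Ω).det ^ 2 * normGram Ω X Y ^ 3 := by
  have h : (fun Ω : ThreeForm => 144 ^ 2 * contractNorm Ω X Y ^ 3) =ᶠ[𝓝 (stdForm 1)]
      fun Ω => (normMatrix Ω).det ^ 2 * normGram Ω X Y ^ 3 := by
    filter_upwards [isGeneric_stdForm_one.mem_nhds (mem_glOrbit_self _)]
    rintro _ ⟨f, rfl⟩
    obtain ⟨A, hA, -⟩ := exists_matrix_symm f
    have := contractNorm_stdForm_one (A.mulVec X) (A.mulVec Y)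
    simp only
    rw [contractNorm_glAct f _ hA, normGram_glAct f _ hA, normMatrix_glAct f _ A hA,
      Matrix.det_smul, Matrix.det_mul, Matrix.det_mul, Matrix.det_transpose, Fintype.card_fin]
    linear_combination A.det ^ 24 * this
  exact congrFun (AnalyticOnNhd.eq_of_eventuallyEq (𝕜 := ℝ)
    (fun Ω _ => analyticAt_const.mul ((analyticAt_contractNorm X Y Ω).pow 3))
    (fun Ω _ => ((analyticAt_det_normMatrix Ω).pow 2).mul ((analyticAt_normGram X Y Ω).pow 3)) h) Ω

/-- A generic 3-form has nondegenerate norm: its orbit cannot lie in a proper analytic subset. -/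
theorem det_normMatrix_ne_zero_of_isGeneric {Ω : ThreeForm} (h : IsGeneric Ω) :
    (normMatrix Ω).det ≠ 0 := by
  intro h₀
  have hz : (fun Ω : ThreeForm => (normMatrix Ω).det) =ᶠ[𝓝 Ω] fun _ => 0 := by
    filter_upwards [IsOpen.mem_nhds h (mem_glOrbit_self _)]
    rintro _ ⟨f, rfl⟩
    obtain ⟨A, hA, -⟩ := exists_matrix_symm f
    simp only
    rw [normMatrix_glAct f _ A hA, Matrix.det_smul, Matrix.det_mul, Matrix.det_mul, h₀]
    ring
  have := congrFun (AnalyticOnNhd.eq_of_eventuallyEq (𝕜 := ℝ)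
    (fun Ω _ => analyticAt_det_normMatrix Ω) (fun Ω _ => analyticAt_const) hz) (stdForm 1)
  rw [normMatrix_stdForm, Matrix.det_diagonal] at this
  simp [stdSign] at this

/-! ### The associated norm of a nondegenerate 3-form -/

theorem exists_pow_nine_eq (y : ℝ) : ∃ c : ℝ, c ^ 9 = y := by
  rcases le_total 0 y with h | h
  · exact ⟨y ^ (((9 : ℕ) : ℝ)⁻¹), Real.rpow_inv_natCast_pow h (by norm_num)⟩
  · refine ⟨-(-y) ^ (((9 : ℕ) : ℝ)⁻¹), ?_⟩
    rw [Odd.neg_pow (by decide), Real.rpow_inv_natCast_pow (by linarith) (by norm_num), neg_neg]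

/-- The product dual to `Ω` with respect to `n_Ω`, multiplied by the determinant of `n_Ω` so as to
be polynomial in `Ω`. -/
def adjugateCross (Ω : ThreeForm) :
    (Fin 7 → ℝ) →ₗ[ℝ] (Fin 7 → ℝ) →ₗ[ℝ] (Fin 7 → ℝ) :=
  LinearMap.mk₂ ℝ (fun X Y => (normMatrix Ω).adjugate.mulVec (contractPair Ω X Y))
    (fun X X' Y => by
      rw [← Matrix.mulVec_add]; congr 1; ext k; exact Ω.map_add_left _ _ _ _)
    (fun r X Y => by
      rw [← Matrix.mulVec_smul]; congr 1; ext k; exact Ω.map_smul_left _ _ _ _)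
    (fun X Y Y' => by
      rw [← Matrix.mulVec_add]; congr 1; ext k; exact Ω.map_add_mid _ _ _ _)
    (fun r X Y => by
      rw [← Matrix.mulVec_smul]; congr 1; ext k; exact Ω.map_smul_mid _ _ _ _)

theorem stdNorm_adjugateCross (Ω : ThreeForm) (X Y Z : Fin 7 → ℝ) :
    stdNorm Ω (adjugateCross Ω X Y) Z = (normMatrix Ω).det * Ω ![X, Y, Z] := by
  rw [stdNorm_symm, stdNorm_eq_dotProduct, adjugateCross, LinearMap.mk₂_apply,
    Matrix.mulVec_mulVec, Matrix.mul_adjugate, Matrix.smul_mulVec, Matrix.one_mulVec,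
    dotProduct_smul, dotProduct_comm, contractPair_dotProduct, smul_eq_mul]

theorem exists_isAssociatedNorm {Ω : ThreeForm} (h : (normMatrix Ω).det ≠ 0) :
    ∃ n, IsAssociatedNorm Ω n := by
  set μ := (normMatrix Ω).det with hμ
  -- the factor `c` is forced by comparing `contractNorm_pow_three` with the cross product identity
  obtain ⟨c, hc⟩ := exists_pow_nine_eq (1 / (144 ^ 2 * μ))
  have hc₀ : c ≠ 0 := by
    rintro rfl
    have : (1 : ℝ) / (144 ^ 2 * μ) ≠ 0 := by positivity
    exact this (by rw [← hc]; norm_num)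
  have hcontract : ∀ X Y, contractNorm Ω X Y = c ^ 3 * μ * normGram Ω X Y := by
    intro X Y
    have h₁ := contractNorm_pow_three Ω X Y
    have hodd : Odd 3 := by decide
    refine hodd.strictMono_pow.injective ?_
    have h₂ : c ^ 9 * (144 ^ 2 * μ) = 1 := by rw [hc]; field_simp
    rw [← hμ] at h₁
    have h₃ : (144 : ℝ) ^ 2 * contractNorm Ω X Y ^ 3 =
        144 ^ 2 * (c ^ 3 * μ * normGram Ω X Y) ^ 3 := by
      linear_combination h₁ - μ ^ 2 * normGram Ω X Y ^ 3 * h₂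
    exact mul_left_cancel₀ (by norm_num) h₃
  have hcross : ∀ X Y Z,
      (c • stdNorm Ω) (((c * μ)⁻¹ • adjugateCross Ω) X Y) Z = Ω ![X, Y, Z] := by
    intro X Y Z
    simp only [LinearMap.smul_apply, map_smul, smul_eq_mul, stdNorm_adjugateCross]
    rw [← hμ]; field_simp
  refine ⟨c • stdNorm Ω, ⟨Pi.basisFun ℝ (Fin 7), c, hc₀, rfl⟩,
    (c * μ)⁻¹ • adjugateCross Ω, hcross, ?_⟩
  have hsymm : ∀ X Y, (c • stdNorm Ω) X Y = (c • stdNorm Ω) Y X := fun X Y => by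
    simp only [LinearMap.smul_apply, stdNorm_symm Ω X Y]
  have hleft : ∀ X, (∀ Y, (c • stdNorm Ω) X Y = 0) → X = 0 := by
    intro X hX
    have : ∀ Y, Y ⬝ᵥ (normMatrix Ω).mulVec X = 0 := fun Y => by
      rw [← stdNorm_eq_dotProduct]
      have := hX Y
      rw [hsymm] at this
      simpa [hc₀] using this
    exact Matrix.eq_zero_of_mulVec_eq_zero h
      (dotProduct_eq_zero _ fun Y => by rw [dotProduct_comm]; exact this Y)
  refine ⟨hsymm, ⟨hleft, fun Y hY => hleft Y fun X => by rw [hsymm]; exact hY X⟩, fun X Y => ?_,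
    fun X Y => ?_, fun X Y => ?_⟩
  · rw [hcross, Ω.self_outer]
  · rw [hcross, Ω.self_right]
  · rw [hcross, ← contractPair_dotProduct, Matrix.det_fin_two_of]
    simp only [LinearMap.smul_apply, smul_eq_mul, dotProduct_smul, stdNorm_symm Ω Y X]
    have := hcontract X Y
    rw [contractNorm] at this
    rw [adjugateCross, LinearMap.mk₂_apply, this, normGram]
    field_simp

/-! ### Cross products on `ℝ⁷` -/

/-- A finite family orthonormal up to signs which does not fill the space can be extended. -/
theorem exists_orthogonal_unit {n : LinearMap.BilinForm ℝ (Fin 7 → ℝ)}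
    (symm : ∀ X Y, n X Y = n Y X) (nondeg : n.Nondegenerate) {m : ℕ} (hm : m < 7)
    (v : Fin m → Fin 7 → ℝ) (s : Fin m → ℝ) (hs : ∀ a, s a = 1 ∨ s a = -1)
    (hv : ∀ a b, n (v a) (v b) = if a = b then s a else 0) :
    ∃ y, (∀ a, n (v a) y = 0) ∧ (n y y = 1 ∨ n y y = -1) := by
  by_contra! hcon
  -- after rescaling, the failure means that the orthogonal complement is totally isotropic
  have hiso : ∀ y, (∀ a, n (v a) y = 0) → n y y = 0 := by
    intro y hy
    by_contra hne
    have habs : 0 < |n y y| := abs_pos.2 hne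
    have hsq : Real.sqrt |n y y| ^ 2 = |n y y| := Real.sq_sqrt habs.le
    have hr : Real.sqrt |n y y| ≠ 0 := (Real.sqrt_pos.2 habs).ne'
    obtain ⟨h₁, h₂⟩ := hcon ((Real.sqrt |n y y|)⁻¹ • y) fun a => by simp [hy a]
    simp only [map_smul, LinearMap.smul_apply, smul_eq_mul] at h₁ h₂
    rcases lt_or_gt_of_ne hne with hlt | hgt
    · rw [abs_of_neg hlt] at *
      apply h₂; field_simp; linarith
    · rw [abs_of_pos hgt] at *
      apply h₁; field_simp; linarith
  have hpolar : ∀ y z, (∀ a, n (v a) y = 0) → (∀ a, n (v a) z = 0) → n y z = 0 := by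
    intro y z hy hz
    have h := hiso (y + z) fun a => by simp [hy a, hz a]
    simp only [map_add, LinearMap.add_apply] at h
    rw [hiso y hy, hiso z hz, symm z y] at h
    linarith
  let P : (Fin 7 → ℝ) → (Fin 7 → ℝ) := fun y => y - ∑ a, (s a * n (v a) y) • v a
  have hP : ∀ y a, n (v a) (P y) = 0 := by
    intro y a
    have hsa : s a * s a = 1 := by rcases hs a with h | h <;> rw [h] <;> norm_num
    simp only [P, map_sub, map_sum, map_smul, hv, smul_eq_mul, mul_ite, mul_zero,
      Finset.sum_ite_eq, Finset.mem_univ, if_true]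
    linear_combination -(n (v a) y) * hsa
  have hP₀ : ∀ y, P y = 0 := by
    intro y
    refine nondeg.1 _ fun z => ?_
    have hz : z = P z + ∑ a, (s a * n (v a) z) • v a := by simp [P]
    rw [hz, map_add, hpolar _ _ (hP y) (hP z), map_sum, zero_add]
    exact Finset.sum_eq_zero fun a _ => by
      rw [map_smul, symm (P y), hP, smul_zero]
  have hspan : Submodule.span ℝ (Set.range v) = ⊤ := by
    refine eq_top_iff.2 fun y _ => ?_
    rw [show y = ∑ a, (s a * n (v a) y) • v a from sub_eq_zero.1 (hP₀ y)]
    exact Submodule.sum_mem _ fun a _ =>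
      Submodule.smul_mem _ _ (Submodule.subset_span (Set.mem_range_self a))
  have hcard := finrank_range_le_card (R := ℝ) v
  rw [Set.finrank, hspan, finrank_top] at hcard
  simp at hcard
  omega

namespace IsCrossProduct

variable {n : LinearMap.BilinForm ℝ (Fin 7 → ℝ)}
  {cross : (Fin 7 → ℝ) →ₗ[ℝ] (Fin 7 → ℝ) →ₗ[ℝ] (Fin 7 → ℝ)} {Ω : ThreeForm}

theorem ext_left (h : IsCrossProduct n cross) {U V : Fin 7 → ℝ} (hUV : ∀ Z, n U Z = n V Z) :
    U = V :=
  sub_eq_zero.1 (h.nondegenerate.1 _ fun Z => by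
    rw [map_sub, LinearMap.sub_apply, hUV, sub_self])

theorem norm_cross_eq (h : IsCrossProduct n cross) (X Y : Fin 7 → ℝ) :
    n (cross X Y) (cross X Y) = n X X * n Y Y - n X Y ^ 2 := by
  rw [h.norm_cross, Matrix.det_fin_two_of, h.symm Y X]; ring

theorem norm_cross_polar (h : IsCrossProduct n cross) (X Y Z : Fin 7 → ℝ) :
    n (cross X Y) (cross X Z) = n X X * n Y Z - n X Y * n X Z := by
  have h₁ := h.norm_cross_eq X (Y + Z)
  simp only [map_add, LinearMap.add_apply] at h₁
  rw [h.norm_cross_eq X Y, h.norm_cross_eq X Z, h.symm (cross X Z), h.symm Z Y] at h₁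
  linarith

theorem anti (h : IsCrossProduct n cross) (hΩ : ∀ X Y Z, n (cross X Y) Z = Ω ![X, Y, Z])
    (X Y : Fin 7 → ℝ) : cross X Y = -cross Y X :=
  h.ext_left fun Z => by
    rw [map_neg, LinearMap.neg_apply, hΩ, hΩ, Ω.swap_left]

/-- The double cross product formula. -/
theorem cross_cross_self (h : IsCrossProduct n cross)
    (hΩ : ∀ X Y Z, n (cross X Y) Z = Ω ![X, Y, Z]) (X Y : Fin 7 → ℝ) :
    cross X (cross X Y) = n X Y • X - n X X • Y :=
  h.ext_left fun Z => by
    have h₁ := h.norm_cross_polar X Z Y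
    rw [hΩ] at h₁
    rw [hΩ, Ω.swap_right, h₁, h.symm Z Y]
    simp only [map_sub, map_smul, LinearMap.sub_apply, LinearMap.smul_apply, smul_eq_mul]
    ring

/-- The polarisation of `cross_cross_self`. -/
theorem cross_cross_polar (h : IsCrossProduct n cross)
    (hΩ : ∀ X Y Z, n (cross X Y) Z = Ω ![X, Y, Z]) (X Y Z : Fin 7 → ℝ) :
    cross X (cross Y Z) =
      -cross Y (cross X Z) + n X Z • Y + n Y Z • X - (2 * n X Y) • Z := by
  have h₁ := h.cross_cross_self hΩ (X + Y) Z
  simp only [map_add, LinearMap.add_apply] at h₁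
  rw [h.cross_cross_self hΩ X Z, h.cross_cross_self hΩ Y Z, h.symm Y X] at h₁
  rw [← sub_eq_zero] at h₁ ⊢
  rw [← h₁]
  module

/-- A cross product on `ℝ⁷` admits two orthogonal vectors of norm `1`, whatever the signature: where
only negative vectors are at hand, the product of two orthogonal ones is positive. -/
theorem exists_orthonormal_pair (h : IsCrossProduct n cross)
    (hΩ : ∀ X Y Z, n (cross X Y) Z = Ω ![X, Y, Z]) :
    ∃ i j, n i i = 1 ∧ n j j = 1 ∧ n i j = 0 := by
  have hi : ∃ i, n i i = 1 := by
    obtain ⟨x, -, hx | hx⟩ := exists_orthogonal_unit h.symm h.nondegenerate (m := 0) (by norm_num)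
      ![] ![] (fun a => a.elim0) fun a => a.elim0
    · exact ⟨x, hx⟩
    obtain ⟨y, hxy, hy | hy⟩ := exists_orthogonal_unit h.symm h.nondegenerate (m := 1)
      (by norm_num) ![x] ![-1] (by simp) (by simp [Fin.forall_fin_one, hx])
    · exact ⟨y, hy⟩
    have hxy' : n x y = 0 := hxy 0
    exact ⟨cross x y, by rw [h.norm_cross_eq, hx, hy, hxy']; norm_num⟩
  obtain ⟨i, hi⟩ := hi
  obtain ⟨y, hiy, hy | hy⟩ := exists_orthogonal_unit h.symm h.nondegenerate (m := 1)
    (by norm_num) ![i] ![1] (by simp) (by simp [Fin.forall_fin_one, hi])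
  · exact ⟨i, y, hi, hy, hiy 0⟩
  replace hiy : n i y = 0 := hiy 0
  have hk : n (cross i y) (cross i y) = -1 := by
    rw [h.norm_cross_eq, hi, hy, hiy]; norm_num
  have hki : n (cross i y) i = 0 := h.orthogonal_left _ _
  have hky : n (cross i y) y = 0 := h.orthogonal_right _ _
  have hyi : n y i = 0 := by rw [h.symm, hiy]
  have hik : n i (cross i y) = 0 := by rw [h.symm, hki]
  have hyk : n y (cross i y) = 0 := by rw [h.symm, hky]
  obtain ⟨l, hl, hll | hll⟩ := exists_orthogonal_unit h.symm h.nondegenerate (m := 3)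
    (by norm_num) ![i, y, cross i y] ![1, -1, -1] (by simp [Fin.forall_fin_succ])
    (by intro a b; fin_cases a <;> fin_cases b <;> simp [hi, hy, hiy, hk, hki, hky, hyi, hik, hyk])
  · exact ⟨i, l, hi, hll, hl 0⟩
  have hyl : n y l = 0 := hl 1
  have hkl : n (cross i y) l = 0 := hl 2
  refine ⟨i, cross y l, hi, by rw [h.norm_cross_eq, hy, hll, hyl]; norm_num, ?_⟩
  rw [h.symm, hΩ, ← hkl, hΩ, Ω.swap_right, Ω.swap_left, neg_neg]

/-- The Cayley–Dickson basis of a cross product on `ℝ⁷`: starting from orthonormal `i`, `j` and a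
unit vector `l` of norm `ε` orthogonal to `i`, `j`, `i × j`, the vectors `i`, `j`, `i × j`, `l × i`,
`l × j`, `l × (i × j)`, `l` multiply like the canonical basis for `stdForm ε`. -/
theorem exists_cayleyDickson (h : IsCrossProduct n cross)
    (hΩ : ∀ X Y Z, n (cross X Y) Z = Ω ![X, Y, Z]) :
    ∃ (ε : ℤˣ) (v : Fin 7 → Fin 7 → ℝ),
      (∀ a b, n (v a) (v b) = if a = b then (stdSign ε a : ℝ) else 0) ∧
      ∀ a b c, a < b → b < c → Ω ![v a, v b, v c] = (stdTable ε a b c : ℝ) := by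
  obtain ⟨i, j, hii, hjj, hij⟩ := h.exists_orthonormal_pair hΩ
  set k := cross i j with hk
  have hkk : n k k = 1 := by rw [hk, h.norm_cross_eq, hii, hjj, hij]; norm_num
  have hki : n k i = 0 := h.orthogonal_left _ _
  have hkj : n k j = 0 := h.orthogonal_right _ _
  have hji : n j i = 0 := by rw [h.symm, hij]
  have hik : n i k = 0 := by rw [h.symm, hki]
  have hjk : n j k = 0 := by rw [h.symm, hkj]
  obtain ⟨l, hl, hε⟩ := exists_orthogonal_unit h.symm h.nondegenerate (m := 3)
    (by norm_num) ![i, j, k] ![1, 1, 1] (by simp [Fin.forall_fin_succ])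
    (by
      intro a b
      fin_cases a <;> fin_cases b <;> simp [hii, hij, hik, hji, hjj, hjk, hki, hkj, hkk])
  have hil : n i l = 0 := hl 0
  have hjl : n j l = 0 := hl 1
  have hkl : n k l = 0 := hl 2
  have hli : n l i = 0 := by rw [h.symm, hil]
  have hlj : n l j = 0 := by rw [h.symm, hjl]
  have hlk : n l k = 0 := by rw [h.symm, hkl]
  obtain ⟨ε, hll⟩ : ∃ ε : ℤˣ, n l l = ((ε : ℤ) : ℝ) := by
    rcases hε with hε | hε
    · exact ⟨1, by simp [hε]⟩
    · exact ⟨-1, by simp [hε]⟩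
  -- the quaternionic relations
  have cjk : cross j k = i := by
    rw [hk, h.anti hΩ i j, map_neg, h.cross_cross_self hΩ, hji, hjj]; simp
  have cik : cross i k = -j := by
    rw [hk, h.cross_cross_self hΩ, hij, hii]; simp
  have cji : cross j i = -k := by rw [h.anti hΩ]
  have ckj : cross k j = -i := by rw [h.anti hΩ, cjk]
  have cki : cross k i = j := by rw [h.anti hΩ, cik, neg_neg]
  -- the rules for doubling
  have d₁ : ∀ a, n a a = 1 → n l a = 0 → cross a (cross l a) = l := fun a haa ha => by
    rw [h.anti hΩ l a, map_neg, h.cross_cross_self hΩ, h.symm, ha, haa]; simp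
  have d₂ : ∀ a b, n a b = 0 → n l a = 0 → n l b = 0 →
      cross a (cross l b) = -cross l (cross a b) := fun a b hab ha hb => by
    rw [h.cross_cross_polar hΩ, hab, hb, h.symm a l, ha]; simp
  have d₃ : ∀ a b, n a b = 0 → n l a = 0 → n l b = 0 → n l (cross a b) = 0 →
      cross (cross l a) (cross l b) = -((ε : ℝ) • cross a b) := fun a b hab ha hb hl => by
    have e₁ : n (cross l a) b = 0 := by
      rw [hΩ, ← hl, h.symm l, hΩ, Ω.swap_left, Ω.swap_right, neg_neg]
    rw [h.cross_cross_polar hΩ, e₁, hb, h.orthogonal_left, h.anti hΩ (cross l a) b,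
      d₂ b a (by rw [h.symm, hab]) hb ha, neg_neg, h.cross_cross_self hΩ, hll,
      h.anti hΩ b a, map_neg, hl]
    simp
  have g₁ : ∀ a b, n (cross l a) (cross l b) = (ε : ℝ) * n a b - n l a * n l b := fun a b => by
    rw [h.norm_cross_polar, hll]
  have g₂ : ∀ a b, n (cross l a) b = n (cross a b) l := fun a b => by
    rw [hΩ, hΩ, Ω.swap_left, Ω.swap_right, neg_neg]
  have g₃ : ∀ a b, n b (cross l a) = n (cross a b) l := fun a b => by rw [h.symm, g₂]
  have g₄ : ∀ a, n (cross a l) l = 0 := fun a => h.orthogonal_right _ _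
  have cii : ∀ a, cross a a = 0 := fun a => h.ext_left fun Z => by
    rw [hΩ, Ω.self_left, map_zero, LinearMap.zero_apply]
  have hgram : ∀ a b, n (![i, j, k, cross l i, cross l j, cross l k, l] a)
      (![i, j, k, cross l i, cross l j, cross l k, l] b) =
        if a = b then (stdSign ε a : ℝ) else 0 := by
    intro a b
    fin_cases a <;> fin_cases b <;>
      simp [stdSign, hii, hij, hik, hji, hjj, hjk, hki, hkj, hkk, hil, hjl, hkl, hli, hlj, hlk, hll,
        cjk, cik, cji, ckj, cki, ← hk, g₁, g₂, g₃, g₄, cii]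
  refine ⟨ε, ![i, j, k, cross l i, cross l j, cross l k, l], hgram, ?_⟩
  have p₀₃ : cross i (cross l i) = l := d₁ i hii hli
  have p₀₄ : cross i (cross l j) = -cross l k := d₂ i j hij hli hlj
  have p₀₅ : cross i (cross l k) = cross l j := by rw [d₂ i k hik hli hlk, cik, map_neg, neg_neg]
  have p₁₃ : cross j (cross l i) = cross l k := by rw [d₂ j i hji hlj hli, cji, map_neg, neg_neg]
  have p₁₄ : cross j (cross l j) = l := d₁ j hjj hlj
  have p₁₅ : cross j (cross l k) = -cross l i := by rw [d₂ j k hjk hlj hlk, cjk]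
  have p₂₃ : cross k (cross l i) = -cross l j := by rw [d₂ k i hki hlk hli, cki]
  have p₂₄ : cross k (cross l j) = cross l i := by rw [d₂ k j hkj hlk hlj, ckj, map_neg, neg_neg]
  have p₂₅ : cross k (cross l k) = l := d₁ k hkk hlk
  have p₃₄ : cross (cross l i) (cross l j) = -((ε : ℝ) • k) := d₃ i j hij hli hlj hlk
  have p₃₅ : cross (cross l i) (cross l k) = (ε : ℝ) • j := by
    rw [d₃ i k hik hli hlk (by rw [cik, map_neg, hlj, neg_zero]), cik, smul_neg, neg_neg]
  have p₄₅ : cross (cross l j) (cross l k) = -((ε : ℝ) • i) := by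
    rw [d₃ j k hjk hlj hlk (by rw [cjk, hli]), cjk]
  intro a b c hab hbc
  rw [← hΩ]
  fin_cases a <;> fin_cases b <;> first
    | exact absurd hab (by decide)
    | fin_cases c <;> first
      | exact absurd hbc (by decide)
      | simp [stdTable, fanoThird, ← hk, cik, cjk, cji, cki, ckj, p₀₃, p₀₄, p₀₅, p₁₃, p₁₄, p₁₅, p₂₃,
          p₂₄, p₂₅, p₃₄, p₃₅, p₄₅, hik, hjj, hjk, hkj, hkk, hil, hjl, hkl, hli, hlj, hlk, hll, g₁,
          g₂, g₃, g₄, cii]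

end IsCrossProduct

/-! ### Classification of the nondegenerate 3-forms -/

theorem mem_glOrbit_of_comp {Ω Ω' : ThreeForm} (A : (Fin 7 → ℝ) →ₗ[ℝ] (Fin 7 → ℝ))
    (hA : ∀ X, A X = 0 → X = 0) (h : ∀ X Y Z, Ω' ![X, Y, Z] = Ω ![A X, A Y, A Z]) :
    Ω' ∈ glOrbit Ω := by
  have hinj : Function.Injective A := (injective_iff_map_eq_zero A).2 hA
  refine ⟨(LinearEquiv.ofInjectiveEndo A hinj).toContinuousLinearEquiv.symm, ?_⟩
  refine ThreeForm.ext_sorted (Pi.basisFun ℝ (Fin 7)) fun i j k _ _ => ?_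
  rw [glAct_apply_three, h]
  rfl

theorem Omega1_mem_glOrbit (e : Module.Basis (Fin 7) ℝ (Module.Dual ℝ (Fin 7 → ℝ))) :
    Omega1 e ∈ glOrbit (stdForm 1) := by
  refine mem_glOrbit_of_comp (LinearMap.pi e) (fun X hX => ?_) fun X Y Z => ?_
  · refine (Module.forall_dual_apply_eq_zero_iff ℝ X).1 fun φ => ?_
    rw [← e.sum_repr φ, LinearMap.sum_apply]
    exact Finset.sum_eq_zero fun i _ => by
      rw [LinearMap.smul_apply, show e i X = 0 from congrFun hX i, smul_zero]
  · simp [Omega1, stdForm, wedge3_apply, coord7, Matrix.det_fin_three]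
    ring

theorem Omega0_mem_glOrbit : Omega0 ∈ glOrbit (stdForm (-1)) := by
  -- `stdForm (-1)` becomes `Omega0` under the substitution `eᵃ = F_a* - E_a*`,
  -- `eᵃ⁺³ = -E_a* - F_a*`, `e⁶ = E₀*`
  let x := coord7
  refine mem_glOrbit_of_comp (LinearMap.pi ![x 4 - x 1, x 5 - x 2, x 6 - x 3, -x 1 - x 4,
    -x 2 - x 5, -x 3 - x 6, x 0]) (fun X hX => ?_) fun X Y Z => ?_
  · have h := fun i => congrFun hX i
    simp [Fin.forall_fin_succ, x, coord7] at h
    obtain ⟨h0, h1, h2, h3, h4, h5, h6⟩ := h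
    ext i
    fin_cases i <;> simp <;> linarith
  · simp [Omega0, stdForm, wedge3_apply, coord7, Matrix.det_fin_three, x]
    ring

theorem det_normMatrix_ne_zero_of_mem_glOrbit {ε : ℤˣ} {Ω : ThreeForm}
    (h : Ω ∈ glOrbit (stdForm ε)) : (normMatrix Ω).det ≠ 0 := by
  obtain ⟨f, rfl⟩ := h
  obtain ⟨A, hA, hdet⟩ := exists_matrix_symm f
  simp only
  have hs : ∀ a, ((stdSign ε a : ℤ) : ℝ) ≠ 0 := fun a => by
    unfold stdSign; split <;> simp
  rw [normMatrix_glAct f _ A hA, Matrix.det_smul, Matrix.det_mul, Matrix.det_mul,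
    Matrix.det_transpose, normMatrix_stdForm, Matrix.det_diagonal]
  have : ∏ a, (-144 : ℝ) * (stdSign ε a : ℤ) ≠ 0 :=
    Finset.prod_ne_zero_iff.2 fun a _ => mul_ne_zero (by norm_num) (hs a)
  positivity

theorem stdNorm_stdForm (ε : ℤˣ) (X Y : Fin 7 → ℝ) :
    stdNorm (stdForm ε) X Y = -144 * ∑ a, (stdSign ε a : ℝ) * (X a * Y a) := by
  rw [stdNorm_eq_dotProduct, normMatrix_stdForm]
  simp only [dotProduct, Matrix.mulVec_diagonal, Finset.mul_sum]
  exact Finset.sum_congr rfl fun _ _ => by ring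

/-- `n_Ω` takes values of both signs. -/
def IsIndefinite (Ω : ThreeForm) : Prop :=
  ∃ X Y, stdNorm Ω X X * stdNorm Ω Y Y < 0

theorem isIndefinite_of_mem_glOrbit {Ω : ThreeForm} (h : Ω ∈ glOrbit (stdForm (-1))) :
    IsIndefinite Ω := by
  obtain ⟨f, rfl⟩ := h
  refine ⟨f (Pi.single 0 1), f (Pi.single 6 1), ?_⟩
  simp only [stdNorm_glAct, ContinuousLinearEquiv.symm_apply_apply, stdNorm_stdForm_single,
    stdNormTable_eq]
  set d := LinearMap.det (f.symm.toLinearEquiv : (Fin 7 → ℝ) →ₗ[ℝ] (Fin 7 → ℝ))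
  have hd : d ≠ 0 := (LinearEquiv.isUnit_det' f.symm.toLinearEquiv).ne_zero
  have : 0 < d ^ 2 := by positivity
  simp [stdSign]
  nlinarith

theorem not_isIndefinite_of_mem_glOrbit {Ω : ThreeForm} (h : Ω ∈ glOrbit (stdForm 1)) :
    ¬ IsIndefinite Ω := by
  obtain ⟨f, rfl⟩ := h
  rintro ⟨X, Y, hXY⟩
  have hpos : ∀ X : Fin 7 → ℝ, 0 ≤ ∑ a, (stdSign 1 a : ℝ) * (X a * X a) := fun X =>
    Finset.sum_nonneg fun a _ => mul_nonneg (by simp [stdSign]) (mul_self_nonneg _)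
  simp only [stdNorm_glAct, stdNorm_stdForm] at hXY
  have := mul_nonneg (mul_nonneg (hpos (f.symm X)) (hpos (f.symm Y)))
    (sq_nonneg (144 * LinearMap.det (f.symm.toLinearEquiv : (Fin 7 → ℝ) →ₗ[ℝ] (Fin 7 → ℝ))))
  simp only [Units.val_one] at hXY
  nlinarith

/-- A 3-form with an associated norm is equivalent to one of the two standard forms, by a basis that
diagonalises the norm. -/
theorem IsAssociatedNorm.exists_basis {Ω : ThreeForm} {n : LinearMap.BilinForm ℝ (Fin 7 → ℝ)}
    (h : IsAssociatedNorm Ω n) :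
    ∃ (ε : ℤˣ) (v : Module.Basis (Fin 7) ℝ (Fin 7 → ℝ)), Ω ∈ glOrbit (stdForm ε) ∧
      ∀ a b, n (v a) (v b) = if a = b then (stdSign ε a : ℝ) else 0 := by
  obtain ⟨-, cross, hΩ, hc⟩ := h
  obtain ⟨ε, v, hv, hΩv⟩ := hc.exists_cayleyDickson hΩ
  have hs : ∀ a, ((stdSign ε a : ℤ) : ℝ) ≠ 0 := fun a => by
    unfold stdSign; split <;> simp
  have hli : LinearIndependent ℝ v := by
    rw [Fintype.linearIndependent_iff]
    intro c hc a
    have h := congrArg (n (v a)) hc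
    simpa [hv, hs] using h
  let b := basisOfLinearIndependentOfCardEqFinrank hli (by simp)
  have hb : ∀ a, b a = v a := fun a => by simp [b]
  refine ⟨ε, b, ⟨b.equivFun.symm.toContinuousLinearEquiv, ?_⟩, fun a c => by rw [hb, hb, hv]⟩
  refine ThreeForm.ext_sorted b fun i j k hij hjk => ?_
  have he : ∀ a, b.equivFun.symm.toContinuousLinearEquiv.symm (b a) = Pi.single a 1 := fun a => by
    change b.equivFun (b a) = _
    ext c
    rw [Module.Basis.equivFun_self, Pi.single_apply]
    simp only [eq_comm]
  rw [glAct_apply_three, he, he, he, stdForm_single, hb, hb, hb, hΩv i j k hij hjk]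

theorem mem_glOrbit_or_of_det_ne_zero {Ω : ThreeForm} (h : (normMatrix Ω).det ≠ 0) :
    Ω ∈ glOrbit (stdForm 1) ∨ Ω ∈ glOrbit (stdForm (-1)) := by
  obtain ⟨n, hn⟩ := exists_isAssociatedNorm h
  obtain ⟨ε, -, hε, -⟩ := hn.exists_basis
  rcases Int.units_eq_one_or ε with rfl | rfl
  · exact Or.inl hε
  · exact Or.inr hε

/-- The orbit of `stdForm (-1)` is cut out by the open conditions that `n_Ω` is nondegenerate and
indefinite. -/
theorem isGeneric_stdForm_neg_one : IsGeneric (stdForm (-1)) := by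
  have h : glOrbit (stdForm (-1)) =
      {Ω | (normMatrix Ω).det ≠ 0} ∩ ⋃ X, ⋃ Y, {Ω | stdNorm Ω X X * stdNorm Ω Y Y < 0} := by
    ext Ω
    simp only [Set.mem_inter_iff, Set.mem_ofPred_eq, Set.mem_iUnion]
    refine ⟨fun h => ⟨det_normMatrix_ne_zero_of_mem_glOrbit h, isIndefinite_of_mem_glOrbit h⟩,
      fun ⟨h₁, h₂⟩ => (mem_glOrbit_or_of_det_ne_zero h₁).resolve_left fun h₃ =>
        not_isIndefinite_of_mem_glOrbit h₃ h₂⟩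
  have hc : ∀ X, Continuous fun Ω => stdNorm Ω X X := fun X =>
    continuous_iff_continuousAt.2 fun Ω => (analyticAt_stdNorm X X Ω).continuousAt
  have hd : Continuous fun Ω => (normMatrix Ω).det :=
    continuous_iff_continuousAt.2 fun Ω => (analyticAt_det_normMatrix Ω).continuousAt
  rw [IsGeneric, h]
  exact (isOpen_ne_fun hd continuous_const).inter <| isOpen_iUnion fun X => isOpen_iUnion fun Y =>
    isOpen_lt ((hc X).mul (hc Y)) continuous_const

/-! ### Uniqueness and signature of the associated norm -/

theorem IsAssociatedNorm.unique {Ω : ThreeForm} {n₁ n₂ : LinearMap.BilinForm ℝ (Fin 7 → ℝ)}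
    (h₁ : IsAssociatedNorm Ω n₁) (h₂ : IsAssociatedNorm Ω n₂) : n₁ = n₂ := by
  have hstd : ∀ n, IsAssociatedNorm Ω n → ∃ c : ℝ, c ≠ 0 ∧ n = c • stdNorm Ω := by
    rintro n ⟨⟨b, c, hc, rfl⟩, -⟩
    obtain ⟨d, hd, h⟩ := exists_normForm_eq_smul_stdNorm Ω b
    exact ⟨c * d, mul_ne_zero hc hd, by rw [h, smul_smul]⟩
  obtain ⟨c₁, hc₁, e₁⟩ := hstd n₁ h₁
  obtain ⟨c₂, hc₂, e₂⟩ := hstd n₂ h₂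
  obtain ⟨t, ht⟩ : ∃ t : ℝ, n₂ = t • n₁ := ⟨c₂ / c₁, by
    rw [e₁, e₂, smul_smul, div_mul_cancel₀ _ hc₁]⟩
  obtain ⟨ε, v, -, hv⟩ := h₁.exists_basis
  obtain ⟨-, cross₁, hΩ₁, hx₁⟩ := h₁
  obtain ⟨-, cross₂, hΩ₂, hx₂⟩ := h₂
  have hcross : cross₁ (v 0) (v 1) = t • cross₂ (v 0) (v 1) := hx₁.ext_left fun Z => by
    rw [hΩ₁, ← hΩ₂, ht, map_smul]; rfl
  -- comparing both cross product identities on the orthonormal pair `v 0`, `v 1` gives `t³ = 1`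
  have g₁ := hx₁.norm_cross_eq (v 0) (v 1)
  have g₂ := hx₂.norm_cross_eq (v 0) (v 1)
  rw [hcross] at g₁
  rw [ht] at g₂
  simp only [map_smul, LinearMap.smul_apply, smul_eq_mul, hv] at g₁ g₂
  simp [stdSign] at g₁ g₂
  set s := n₁ (cross₂ (v 0) (v 1)) (cross₂ (v 0) (v 1))
  have ht₃ : t ^ 3 = 1 := by
    rcases g₂ with h | h
    · rw [h] at g₁; linear_combination g₁
    · rw [h] at g₁; norm_num at g₁
  have ht₁ : t = 1 := by
    have : (fun x : ℝ => x ^ 3) t = (fun x : ℝ => x ^ 3) 1 := by simpa using ht₃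
    exact (show Odd 3 by decide).strictMono_pow.injective this
  rw [ht, ht₁, one_smul]

theorem hasSignature_of_basis {n : LinearMap.BilinForm ℝ (Fin 7 → ℝ)} {ε : ℤˣ}
    (v : Module.Basis (Fin 7) ℝ (Fin 7 → ℝ))
    (hv : ∀ a b, n (v a) (v b) = if a = b then (stdSign ε a : ℝ) else 0) :
    HasSignature n {a | stdSign ε a < 0}.ncard {a | 0 < stdSign ε a}.ncard := by
  have h : n.toQuadraticMap.Equivalent
      (QuadraticMap.weightedSumSquares ℝ fun a => (stdSign ε a : ℝ)) := by
    refine ⟨⟨v.equivFun, fun X => ?_⟩⟩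
    change _ = n X X
    conv_rhs => rw [← v.sum_equivFun X]
    simp only [AddHom.toFun_eq_coe, LinearMap.coe_toAddHom, LinearEquiv.coe_coe,
      QuadraticMap.weightedSumSquares_apply, map_sum, map_smul, LinearMap.sum_apply,
      LinearMap.smul_apply, hv, smul_eq_mul, mul_ite, mul_zero,
      Finset.sum_ite_eq', Finset.mem_univ, if_true]
    exact Finset.sum_congr rfl fun a _ => by ring
  constructor
  · rw [QuadraticForm.sigNeg_of_equiv_weightedSumSquares h]
    simp
  · rw [QuadraticForm.sigPos_of_equiv_weightedSumSquares h]
    simp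

end

theorem mainTheorem2 (e : Module.Basis (Fin 7) ℝ (Module.Dual ℝ (Fin 7 → ℝ))) :
    {O : Set ThreeForm | ∃ Ω : ThreeForm, IsGeneric Ω ∧ O = glOrbit Ω} =
        {glOrbit Omega0, glOrbit (Omega1 e)} ∧
      glOrbit Omega0 ≠ glOrbit (Omega1 e) ∧
      (∀ Ω : ThreeForm, IsGeneric Ω →
        ∃! n : LinearMap.BilinForm ℝ (Fin 7 → ℝ), IsAssociatedNorm Ω n) ∧
      (∀ (Ω : ThreeForm) (n : LinearMap.BilinForm ℝ (Fin 7 → ℝ)), IsAssociatedNorm Ω n →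
        (Ω ∈ glOrbit Omega0 → HasSignature n 4 3) ∧
        (Ω ∈ glOrbit (Omega1 e) → HasSignature n 0 7)) := by
  rw [glOrbit_eq_of_mem Omega0_mem_glOrbit, glOrbit_eq_of_mem (Omega1_mem_glOrbit e)]
  refine ⟨?_, ?_, ?_, ?_⟩
  · ext O
    simp only [Set.mem_ofPred_eq, Set.mem_insert_iff, Set.mem_singleton_iff]
    constructor
    · rintro ⟨Ω, hΩ, rfl⟩
      rcases mem_glOrbit_or_of_det_ne_zero (det_normMatrix_ne_zero_of_isGeneric hΩ) with h | h
      · exact Or.inr (glOrbit_eq_of_mem h)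
      · exact Or.inl (glOrbit_eq_of_mem h)
    · rintro (rfl | rfl)
      · exact ⟨_, isGeneric_stdForm_neg_one, rfl⟩
      · exact ⟨_, isGeneric_stdForm_one, rfl⟩
  · intro h
    have h₁ : stdForm 1 ∈ glOrbit (stdForm (-1)) := h ▸ mem_glOrbit_self _
    exact not_isIndefinite_of_mem_glOrbit (mem_glOrbit_self _) (isIndefinite_of_mem_glOrbit h₁)
  · intro Ω hΩ
    obtain ⟨n, hn⟩ := exists_isAssociatedNorm (det_normMatrix_ne_zero_of_isGeneric hΩ)
    exact ⟨n, hn, fun n' hn' => hn'.unique hn⟩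
  · intro Ω n hn
    obtain ⟨ε, v, hε, hv⟩ := hn.exists_basis
    have hsig := hasSignature_of_basis v hv
    rcases Int.units_eq_one_or ε with rfl | rfl
    · refine ⟨fun h => absurd (isIndefinite_of_mem_glOrbit h) (not_isIndefinite_of_mem_glOrbit hε),
        fun _ => ?_⟩
      have h₀ : {a | stdSign ((1 : ℤˣ) : ℤ) a < 0}.ncard = 0 := by
        rw [Set.ncard_eq_toFinset_card']
        decide
      have h₁ : {a | 0 < stdSign ((1 : ℤˣ) : ℤ) a}.ncard = 7 := by
        rw [Set.ncard_eq_toFinset_card']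
        decide
      rwa [h₀, h₁] at hsig
    · refine ⟨fun _ => ?_,
        fun h => absurd (isIndefinite_of_mem_glOrbit hε) (not_isIndefinite_of_mem_glOrbit h)⟩
      have h₀ : {a | stdSign ((-1 : ℤˣ) : ℤ) a < 0}.ncard = 4 := by
        rw [Set.ncard_eq_toFinset_card']
        decide
      have h₁ : {a | 0 < stdSign ((-1 : ℤˣ) : ℤ) a}.ncard = 3 := by
        rw [Set.ncard_eq_toFinset_card']
        decide
      rwa [h₀, h₁] at hsig
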